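/- Let $k\geqslant 4$ be an even integer, and let $\Gamma\subset \mathrm{SL}_2(\mathbb R)$ be a discrete subgroup with $\Gamma\backslash\mathbb H$ of finite hyperbolic volume. Write $\mathbf e(z)=e^{2\pi i z}$, let $(f|_k\gamma)(z)=(cz+d)^{-k}f(\gamma z)$ for $\gamma=\left(\begin{smallmatrix}a&b\\c&d\end{smallmatrix}\right)\in \mathrm{SL}_2(\mathbb R)$, and let a bar denote the image in $\mathrm{SL}_2(\mathbb R)/\{\pm I\}$. Complex powers are principal. Let $\mathfrak a$ be a cusp of $\Gamma$ with stabilizer $\Gamma_{\mathfrak a}$, and let $\sigma_{\mathfrak a}\in\mathrm{SL}_2(\mathbb R)$ be a scaling matrix: $\sigma_{\mathfrak a}\infty=\mathfrak a$ and $\sigma_{\mathfrak a}^{-1}\overline\Gamma_{\mathfrak a}\sigma_{\mathfrak a}=\{\pm\left(\begin{smallmatrix}1&j\\0&1\end{smallmatrix}\right): j\in\mathbb Z\}$. Let $\eta=(\eta_1,\eta_2)$ be an ordered pair of distinct points of $\mathbb R\cup\{\infty\}$ both fixed by some hyperbolic element of $\Gamma$, let $\Gamma_\eta$ be the subgroup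 of $\Gamma$ fixing $\eta_1$ and $\eta_2$, let $\sigma_\eta\in\mathrm{SL}_2(\mathbb R)$ satisfy $\sigma_\eta 0=\eta_1$, $\sigma_\eta\infty=\eta_2$, and let $\ell_\eta>0$ be the number with $\sigma_\eta^{-1}\overline\Gamma_\eta\sigma_\eta=\{\pm\left(\begin{smallmatrix}e^{j\ell_\eta/2}&0\\0&e^{-j\ell_\eta/2}\end{smallmatrix}\right): j\in\mathbb Z\}$. For $m\in\mathbb Z$ let $$P_{\mathfrak a,m}(z)=\sum_{\gamma\in\Gamma_{\mathfrak a}\backslash\Gamma}\bigl(\mathbf e(m\,\cdot\,)\big|_k\,\sigma_{\mathfrak a}^{-1}\gamma\bigr)(z)\qquad(z\in\mathbb H).$$ The hyperbolic Fourier coefficients $c_\eta(n;f)$, $n\in\mathbb Z$, of $f$ at $\eta$ are the numbers with $(f|_k\sigma_\eta)(z)=\sum_{n\in\mathbb Z}c_\eta(n;f)\,z^{-k/2+2\pi i n/\ell_\eta}$ for all $z\in\mathbb H$. Let $C_{\mathfrak a\eta}=\{cd : \left(\begin{smallmatrix}a&b\\c&d\end{smallmatrix}\right)\in\sigma_{\mathfrak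 a}^{-1}\Gamma\sigma_\eta\}$ (a set of nonzero reals) and, for $C\in C_{\mathfrak a\eta}$, $$S_{\mathfrak a\eta}(m,n;C)=\sum_{\substack{\gamma\in\Gamma_{\mathfrak a}\backslash\Gamma/\Gamma_\eta\\ \left(\begin{smallmatrix}a&b\\c&d\end{smallmatrix}\right)=\sigma_{\mathfrak a}^{-1}\gamma\sigma_\eta,\ cd=C}}\mathbf e\left(m\left(\frac a{2c}+\frac b{2d}\right)+\frac n{\ell_\eta}\log\left|\frac cd\right|\right),$$ $$S^\star_{\mathfrak a\eta}(m,n;C)=\exp\left(-\pi^2n\,(\mathrm{sgn}(C)+1)/\ell_\eta-\pi i m/C\right)S_{\mathfrak a\eta}(m,n;C).$$ For real $r\neq0$ and $0<y<\pi$ let $$I_{\mathfrak a\eta}(m,n;r)=\int_{-\infty+iy}^{\infty+iy}\frac{\mathbf e\left(m\,\frac{\mathrm{sgn}(r)e^u-1}{2r(\mathrm{sgn}(r)e^u+1)}\right)e^{u(k/2-2\pi i n/\ell_\eta)}}{(\mathrm{sgn}(r)e^u+1)^k}\,\frac{du}{\ell_\eta}.$$ Let ${}_1F_1(\alpha;\beta;x)=\sum_{j\geqslant0}\frac{(\alpha)_j}{(\beta)_j}\frac{x^j}{j!}$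 and let $B$ be the Beta function. Then, for every $m\in\mathbb Z$, the series $P_{\mathfrak a,m}(z)$ converges absolutely for all $z\in\mathbb H$, each sum $S_{\mathfrak a\eta}(m,n;C)$ is finite, the hyperbolic Fourier expansion of $P_{\mathfrak a,m}$ at $\eta$ exists with unique coefficients, and for all $n\in\mathbb Z$ $$c_\eta(n;P_{\mathfrak a,m})=\frac{e^{2\pi^2n/\ell_\eta}}{\ell_\eta}\,B\left(\frac k2+\frac{2\pi i n}{\ell_\eta},\frac k2-\frac{2\pi i n}{\ell_\eta}\right)\sum_{C\in C_{\mathfrak a\eta}}{}_1F_1\left(\frac k2-\frac{2\pi i n}{\ell_\eta};k;\frac{2\pi i m}{C}\right)\frac{S^\star_{\mathfrak a\eta}(m,n;C)}{C^{k/2}}$$ and, for every choice of $0<y<\pi$ in the integral, $$c_\eta(n;P_{\mathfrak a,m})=\sum_{C\in C_{\mathfrak a\eta}}|C|^{-k/2}\,I_{\mathfrak a\eta}(m,n;C)\,S_{\mathfrak a\eta}(m,n;C),$$ where both series over $C$ and the integrals converge absolutely. -/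

import Mathlib

open scoped MatrixGroups UpperHalfPlane

noncomputable section

namespace HyperbolicExpansion

/-- `Γ ≤ SL(2,ℝ)` is a Fuchsian group of the first kind: it is discrete and `Γ \ ℍ` has finite
hyperbolic volume, i.e. the translates of some measurable set of finite hyperbolic area
(`volume` on `ℍ` is `dx dy / y ^ 2`) cover `ℍ`. -/
structure IsFuchsianFirstKind (Γ : Subgroup SL(2, ℝ)) : Prop where
  discrete : DiscreteTopology Γ
  finite_covolume : ∃ D : Set ℍ, MeasurableSet D ∧ MeasureTheory.volume D < ⊤ ∧
    ∀ z : ℍ, ∃ γ ∈ Γ, γ • z ∈ D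

/-- The subgroup of `Γ` fixing the boundary point `x ∈ ℝ ∪ {∞}`. -/
def pointStab (Γ : Subgroup SL(2, ℝ)) (x : OnePoint ℝ) : Subgroup Γ :=
  ((MulAction.stabilizer (GL (Fin 2) ℝ) x).comap Matrix.SpecialLinearGroup.toGL).subgroupOf Γ

/-- The subgroup of `Γ` fixing both points of the ordered pair `η = (η₁, η₂)`. -/
def pairStab (Γ : Subgroup SL(2, ℝ)) (η₁ η₂ : OnePoint ℝ) : Subgroup Γ :=
  pointStab Γ η₁ ⊓ pointStab Γ η₂

/-- `σ⁻¹ H̄ σ`, as the set of all `±σ⁻¹ γ σ` with `γ ∈ H`. -/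
def signedConj {Γ : Subgroup SL(2, ℝ)} (H : Subgroup Γ) (σ : SL(2, ℝ)) : Set SL(2, ℝ) :=
  {g | ∃ γ ∈ H, g = σ⁻¹ * (γ : SL(2, ℝ)) * σ ∨ g = -(σ⁻¹ * (γ : SL(2, ℝ)) * σ)}

/-- The matrix with rows `(1, x)`, `(0, 1)`. -/
def translation (x : ℝ) : SL(2, ℝ) := ⟨!![1, x; 0, 1], by simp⟩

/-- The matrix with rows `(e^(x/2), 0)`, `(0, e^(-x/2))`. -/
def dilation (x : ℝ) : SL(2, ℝ) :=
  ⟨!![Real.exp (x / 2), 0; 0, Real.exp (-(x / 2))], by simp [← Real.exp_add]⟩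

/-- `σ` is a scaling matrix for the cusp `𝔞` of `Γ`. -/
structure IsCuspScaling (Γ : Subgroup SL(2, ℝ)) (𝔞 : OnePoint ℝ) (σ : SL(2, ℝ)) : Prop where
  map_infty : (σ : GL (Fin 2) ℝ) • (OnePoint.infty : OnePoint ℝ) = 𝔞
  conj_eq : signedConj (pointStab Γ 𝔞) σ =
    {g | ∃ j : ℤ, g = translation j ∨ g = -translation j}

/-- `(η₁, η₂)` is an ordered hyperbolic fixed pair for `Γ`. -/
def IsHyperbolicPair (Γ : Subgroup SL(2, ℝ)) (η₁ η₂ : OnePoint ℝ) : Prop :=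
  η₁ ≠ η₂ ∧ ∃ γ ∈ Γ, (γ : GL (Fin 2) ℝ).IsHyperbolic ∧
    (γ : GL (Fin 2) ℝ) • η₁ = η₁ ∧ (γ : GL (Fin 2) ℝ) • η₂ = η₂

/-- `σ` is a scaling matrix for the hyperbolic fixed pair `(η₁, η₂)` of `Γ`, and `ℓ = ℓ_η` is the
positive number with `σ⁻¹ Γ̄_η σ = {± diag(e^(jℓ/2), e^(-jℓ/2)) : j ∈ ℤ}`. -/
structure IsHyperbolicScaling (Γ : Subgroup SL(2, ℝ)) (η₁ η₂ : OnePoint ℝ) (σ : SL(2, ℝ))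
    (ℓ : ℝ) : Prop where
  map_zero : (σ : GL (Fin 2) ℝ) • ((0 : ℝ) : OnePoint ℝ) = η₁
  map_infty : (σ : GL (Fin 2) ℝ) • (OnePoint.infty : OnePoint ℝ) = η₂
  length_pos : 0 < ℓ
  conj_eq : signedConj (pairStab Γ η₁ η₂) σ =
    {g | ∃ j : ℤ, g = dilation (j * ℓ) ∨ g = -dilation (j * ℓ)}

/-- `𝐞(z) = e^(2πiz)`. -/
def e (z : ℂ) : ℂ := Complex.exp (2 * Real.pi * Complex.I * z)

/-- The coset space `Γ_𝔞 \ Γ`. -/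
abbrev CuspCosets (Γ : Subgroup SL(2, ℝ)) (𝔞 : OnePoint ℝ) : Type :=
  Quotient (QuotientGroup.rightRel (pointStab Γ 𝔞))

/-- The term `e(m z) |_k σ⁻¹ γ` of the parabolic Poincaré series. -/
def poincareTerm (k : ℕ) (m : ℤ) (σ γ : SL(2, ℝ)) : ℍ → ℂ :=
  SlashAction.map (k : ℤ) ((σ⁻¹ * γ : SL(2, ℝ)) : GL (Fin 2) ℝ) (fun w : ℍ => e (m * (w : ℂ)))

/-- The weight `k` parabolic Poincaré series `P_{𝔞,m}`, where `σ` is the scaling matrix of the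
cusp `𝔞`; the sum is over representatives of `Γ_𝔞 \ Γ`. -/
def poincareSeries (Γ : Subgroup SL(2, ℝ)) (𝔞 : OnePoint ℝ) (σ : SL(2, ℝ)) (k : ℕ) (m : ℤ) :
    ℍ → ℂ :=
  fun z => ∑' q : CuspCosets Γ 𝔞, poincareTerm k m σ (q.out : Γ) z

/-- The numbers `c n` are the coefficients of a hyperbolic Fourier expansion of `f` (with scaling
matrix `σ` and length `ℓ`): for all `z ∈ ℍ`,
`(f |_k σ)(z) = ∑_{n ∈ ℤ} c n * z ^ (-k/2 + 2πin/ℓ)` with the principal branch of the power. -/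
def IsHyperbolicExpansion (k : ℕ) (σ : SL(2, ℝ)) (ℓ : ℝ) (f : ℍ → ℂ) (c : ℤ → ℂ) : Prop :=
  ∀ z : ℍ, HasSum
    (fun n : ℤ => c n * (z : ℂ) ^ (-(k : ℂ) / 2 + 2 * Real.pi * Complex.I * n / ℓ))
    (SlashAction.map (k : ℤ) (σ : GL (Fin 2) ℝ) f z)

/-- The product `c * d` of the entries of the lower row of a matrix. -/
def lowerProd (M : SL(2, ℝ)) : ℝ := M 1 0 * M 1 1

/-- The set `C_{𝔞η}` of all products `cd` for matrices in `σ_𝔞⁻¹ Γ σ_η`. -/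
def CSet (Γ : Subgroup SL(2, ℝ)) (σ𝔞 ση : SL(2, ℝ)) : Set ℝ :=
  {C | ∃ γ ∈ Γ, C = lowerProd (σ𝔞⁻¹ * γ * ση)}

/-- The double coset space `Γ_𝔞 \ Γ / Γ_η`. -/
abbrev DoubleCosets (Γ : Subgroup SL(2, ℝ)) (𝔞 η₁ η₂ : OnePoint ℝ) : Type :=
  DoubleCoset.Quotient (pointStab Γ 𝔞 : Set Γ) (pairStab Γ η₁ η₂ : Set Γ)

/-- The matrix `σ_𝔞⁻¹ γ σ_η`, with `γ` a representative of the double coset `q`. -/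
def repMatrix {Γ : Subgroup SL(2, ℝ)} {𝔞 η₁ η₂ : OnePoint ℝ} (σ𝔞 ση : SL(2, ℝ))
    (q : DoubleCosets Γ 𝔞 η₁ η₂) : SL(2, ℝ) :=
  σ𝔞⁻¹ * ((Quotient.out q : Γ) : SL(2, ℝ)) * ση

/-- The double cosets that contribute to the Kloosterman sum with parameter `C`. -/
def kloostermanIndex (Γ : Subgroup SL(2, ℝ)) (𝔞 η₁ η₂ : OnePoint ℝ) (σ𝔞 ση : SL(2, ℝ)) (C : ℝ) :
    Set (DoubleCosets Γ 𝔞 η₁ η₂) :=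
  {q | lowerProd (repMatrix σ𝔞 ση q) = C}

/-- The summand `𝐞(m (a/(2c) + b/(2d)) + (n/ℓ) log |c/d|)` for the matrix `M = (a b; c d)`. -/
def kloostermanTerm (ℓ : ℝ) (m n : ℤ) (M : SL(2, ℝ)) : ℂ :=
  e ((m * (M 0 0 / (2 * M 1 0) + M 0 1 / (2 * M 1 1)) +
    n / ℓ * Real.log |M 1 0 / M 1 1| : ℝ) : ℂ)

/-- The generalized Kloosterman sum `S_{𝔞η}(m,n;C)`. -/
def kloosterman (Γ : Subgroup SL(2, ℝ)) (𝔞 η₁ η₂ : OnePoint ℝ) (σ𝔞 ση : SL(2, ℝ)) (ℓ : ℝ)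
    (m n : ℤ) (C : ℝ) : ℂ :=
  ∑ᶠ q ∈ kloostermanIndex Γ 𝔞 η₁ η₂ σ𝔞 ση C, kloostermanTerm ℓ m n (repMatrix σ𝔞 ση q)

/-- The renormalized Kloosterman sum
`S*_{𝔞η}(m,n;C) = exp(-π² n (sgn C + 1)/ℓ - πim/C) S_{𝔞η}(m,n;C)`. -/
def kloostermanStar (Γ : Subgroup SL(2, ℝ)) (𝔞 η₁ η₂ : OnePoint ℝ) (σ𝔞 ση : SL(2, ℝ)) (ℓ : ℝ)
    (m n : ℤ) (C : ℝ) : ℂ :=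
  Complex.exp (-(Real.pi : ℂ) ^ 2 * n * ((Real.sign C : ℂ) + 1) / ℓ
      - Real.pi * Complex.I * m / C) *
    kloosterman Γ 𝔞 η₁ η₂ σ𝔞 ση ℓ m n C

/-- The integrand of the parabolic/hyperbolic integral at the complex number `u`. -/
def parHypIntegrand (k : ℕ) (ℓ : ℝ) (m n : ℤ) (r : ℝ) (u : ℂ) : ℂ :=
  e (m * ((Real.sign r * Complex.exp u - 1) / (2 * r * (Real.sign r * Complex.exp u + 1)))) *
    Complex.exp (u * ((k : ℂ) / 2 - 2 * Real.pi * Complex.I * n / ℓ)) /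
    (Real.sign r * Complex.exp u + 1) ^ k / ℓ

/-- The integral `I_{𝔞η}(m,n;r)`, taken over the horizontal line `Im u = y`. -/
def parHypIntegral (k : ℕ) (ℓ : ℝ) (m n : ℤ) (r y : ℝ) : ℂ :=
  ∫ t : ℝ, parHypIntegrand k ℓ m n r (t + y * Complex.I)

/-- The confluent hypergeometric series `₁F₁(a; b; x)`. -/
def hyp1F1 (a b x : ℂ) : ℂ :=
  ∑' j : ℕ, (ascPochhammer ℂ j).eval a / (ascPochhammer ℂ j).eval b * (x ^ j / (j.factorial : ℂ))

/-- The term of the coefficient formula belonging to `C`: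
`₁F₁(k/2 - 2πin/ℓ; k; 2πim/C) S*_{𝔞η}(m,n;C) / C^(k/2)`. Here `k` is even, so that the division
`k / 2` in the last exponent is exact. -/
def coeffTerm (Γ : Subgroup SL(2, ℝ)) (𝔞 η₁ η₂ : OnePoint ℝ) (σ𝔞 ση : SL(2, ℝ)) (ℓ : ℝ)
    (k : ℕ) (m n : ℤ) (C : ℝ) : ℂ :=
  hyp1F1 ((k : ℂ) / 2 - 2 * Real.pi * Complex.I * n / ℓ) k (2 * Real.pi * Complex.I * m / C) *
    (kloostermanStar Γ 𝔞 η₁ η₂ σ𝔞 ση ℓ m n C / (C : ℂ) ^ (k / 2))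

end HyperbolicExpansion

end

open scoped MatrixGroups UpperHalfPlane

noncomputable section

namespace HyperbolicExpansion

/-! Put z = e^u. The strip 0 < Im u < π corresponds to the upper half-plane, and e^(ku/2)
(P|σ_η)(e^u) has period ℓ there, because dilations become translations of u. A hyperbolic expansion
of P is therefore an ordinary Fourier expansion on every horizontal line, and the coefficients come
from unfolding.

Convergence. By a Shimizu-type argument (`exists_lower_left_bound`), lower rows (c, d) of matrices
in different cosets of Γ_𝔞 have wedge |cd' - dc'| bounded below. Hence a disc of radius √X contains
O(X) of them, and the sum of (c² + d²)⁻² converges (`summable_of_separated`). For k ≥ 4 this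
dominates the Poincaré series locally uniformly.

Unfolding. An element fixing a cusp has trace ±2, while the nontrivial elements of Γ_η modulo sign
are hyperbolic. So Γ_𝔞\Γ is in bijection with (Γ_𝔞\Γ/Γ_η) × ℤ (`cosetEquiv`), and the sum over ℤ
turns the integral over one period into an integral over the whole line (`hasSum_integral_unfold`).
After the shift of u by log|d/c|, the integrand of a double coset is a unimodular Kloosterman phase
times a function of cd alone (`stripTerm_mul_exp_eq`). Grouping by C = cd gives the integral
formula.

Evaluation. Expanding the exponential in powers of e^u/(1 + e^u) gives Beta integrals, which sum to
₁F₁; a contour shift shows that the line is irrelevant (`parHypIntegral_eq`). The rescaled Fourier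
coefficient is thus the same for all 0 < y < π. Comparing the lines on both sides of a given one
gives geometric decay of the Fourier coefficients, so the expansion converges absolutely; uniqueness
is orthogonality on one line. -/

section

variable {Γ : Subgroup SL(2, ℝ)} {𝔞 η₁ η₂ : OnePoint ℝ} {σ ση : SL(2, ℝ)} {ℓ : ℝ}

/-! ### Entries and traces of 2 × 2 matrices. -/

section MatrixEntries

theorem inv_00 (g : SL(2, ℝ)) : g⁻¹ 0 0 = g 1 1 := by
  rw [Matrix.SpecialLinearGroup.SL2_inv_expl]; rfl

theorem inv_01 (g : SL(2, ℝ)) : g⁻¹ 0 1 = -g 0 1 := by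
  rw [Matrix.SpecialLinearGroup.SL2_inv_expl]; rfl

theorem inv_10 (g : SL(2, ℝ)) : g⁻¹ 1 0 = -g 1 0 := by
  rw [Matrix.SpecialLinearGroup.SL2_inv_expl]; rfl

theorem inv_11 (g : SL(2, ℝ)) : g⁻¹ 1 1 = g 0 0 := by
  rw [Matrix.SpecialLinearGroup.SL2_inv_expl]; rfl

theorem mul_entry (g h : SL(2, ℝ)) (i j : Fin 2) :
    (g * h) i j = g i 0 * h 0 j + g i 1 * h 1 j := by
  rw [Matrix.SpecialLinearGroup.coe_mul, Matrix.mul_apply, Fin.sum_univ_two]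

theorem neg_entry (g : SL(2, ℝ)) (i j : Fin 2) : (-g) i j = -g i j := by
  rw [Matrix.SpecialLinearGroup.coe_neg]; rfl

theorem det_entries (g : SL(2, ℝ)) : g 0 0 * g 1 1 - g 0 1 * g 1 0 = 1 := by
  rw [← Matrix.det_fin_two]; exact g.det_coe

/-- The trace of a matrix. -/
def tr (g : SL(2, ℝ)) : ℝ := g 0 0 + g 1 1

theorem tr_conj (g h : SL(2, ℝ)) : tr (g * h * g⁻¹) = tr h := by
  have := det_entries g
  simp only [tr, mul_entry, inv_00, inv_01, inv_10, inv_11]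
  linear_combination (h 0 0 + h 1 1) * this

theorem tr_neg (g : SL(2, ℝ)) : tr (-g) = -tr g := by
  simp only [tr, neg_entry]; ring

@[simp] theorem translation_00 (x : ℝ) : translation x 0 0 = 1 := rfl
@[simp] theorem translation_01 (x : ℝ) : translation x 0 1 = x := rfl
@[simp] theorem translation_10 (x : ℝ) : translation x 1 0 = 0 := rfl
@[simp] theorem translation_11 (x : ℝ) : translation x 1 1 = 1 := rfl
@[simp] theorem dilation_00 (x : ℝ) : dilation x 0 0 = Real.exp (x / 2) := rfl
@[simp] theorem dilation_01 (x : ℝ) : dilation x 0 1 = 0 := rfl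
@[simp] theorem dilation_10 (x : ℝ) : dilation x 1 0 = 0 := rfl
@[simp] theorem dilation_11 (x : ℝ) : dilation x 1 1 = Real.exp (-(x / 2)) := rfl

theorem ext_entries {g h : SL(2, ℝ)} (h00 : g 0 0 = h 0 0) (h01 : g 0 1 = h 0 1)
    (h10 : g 1 0 = h 1 0) (h11 : g 1 1 = h 1 1) : g = h := by
  ext i j
  fin_cases i <;> fin_cases j <;> assumption

theorem translation_add (x y : ℝ) : translation (x + y) = translation x * translation y := by
  apply ext_entries <;> simp only [mul_entry, translation_00, translation_01, translation_10,
    translation_11] <;> ring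

theorem dilation_add (x y : ℝ) : dilation (x + y) = dilation x * dilation y := by
  apply ext_entries <;> simp only [mul_entry, dilation_00, dilation_01, dilation_10,
    dilation_11, add_div, neg_add, Real.exp_add] <;> ring

theorem dilation_zero : dilation 0 = 1 := by
  apply ext_entries <;> simp

theorem dilation_neg (x : ℝ) : dilation (-x) = (dilation x)⁻¹ := by
  rw [eq_inv_iff_mul_eq_one, ← dilation_add, neg_add_cancel, dilation_zero]

/-- The trace is 2 cosh(x/2). This separates hyperbolic elements from those fixing a cusp. -/
theorem tr_dilation_eq_two {x : ℝ} (h : tr (dilation x) = 2 ∨ tr (dilation x) = -2) : x = 0 := by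
  simp only [tr, dilation_00, dilation_11] at h
  have h1 := Real.exp_pos (x / 2)
  have h2 := Real.exp_pos (-(x / 2))
  have h3 : Real.exp (x / 2) * Real.exp (-(x / 2)) = 1 := by simp [← Real.exp_add]
  rcases h with h | h
  · have : Real.exp (x / 2) = 1 := by nlinarith [sq_nonneg (Real.exp (x / 2) - 1)]
    rw [Real.exp_eq_one_iff] at this
    linarith
  · linarith

end MatrixEntries

/-! ### The stabilizer of a cusp and the separation of lower rows. -/

section Cusp

theorem mem_pointStab_iff (hσ : IsCuspScaling Γ 𝔞 σ) (γ : Γ) :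
    γ ∈ pointStab Γ 𝔞 ↔ (σ⁻¹ * (γ : SL(2, ℝ)) * σ) 1 0 = 0 := by
  have key : γ ∈ pointStab Γ 𝔞 ↔ ((γ : SL(2, ℝ)) : GL (Fin 2) ℝ) • 𝔞 = 𝔞 := Iff.rfl
  have h2 := OnePoint.smul_infty_eq_self_iff (K := ℝ)
    (g := ((σ⁻¹ * (γ : SL(2, ℝ)) * σ : SL(2, ℝ)) : GL (Fin 2) ℝ))
  rw [key, ← hσ.map_infty]
  refine Iff.trans ?_ h2
  rw [map_mul, map_mul, map_inv, mul_assoc, mul_smul, inv_smul_eq_iff, mul_smul]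

theorem exists_eq_translation (hσ : IsCuspScaling Γ 𝔞 σ) {γ : Γ} (hγ : γ ∈ pointStab Γ 𝔞) :
    ∃ j : ℤ, σ⁻¹ * (γ : SL(2, ℝ)) * σ = translation j ∨
      σ⁻¹ * (γ : SL(2, ℝ)) * σ = -translation j := by
  have : σ⁻¹ * (γ : SL(2, ℝ)) * σ ∈ signedConj (pointStab Γ 𝔞) σ := ⟨γ, hγ, Or.inl rfl⟩
  rwa [hσ.conj_eq] at this

/-- The stabilizer is known only up to sign, so translation by 1 may occur only as its negative;
squaring removes the sign. -/
theorem exists_mem_translation_two (hσ : IsCuspScaling Γ 𝔞 σ) :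
    ∃ γ : Γ, σ⁻¹ * (γ : SL(2, ℝ)) * σ = translation 2 := by
  have : translation ((1 : ℤ) : ℝ) ∈ signedConj (pointStab Γ 𝔞) σ := by
    rw [hσ.conj_eq]; exact ⟨1, Or.inl rfl⟩
  obtain ⟨γ, -, h⟩ := this
  refine ⟨γ * γ, ?_⟩
  have e : σ⁻¹ * ((γ * γ : Γ) : SL(2, ℝ)) * σ =
      (σ⁻¹ * (γ : SL(2, ℝ)) * σ) * (σ⁻¹ * (γ : SL(2, ℝ)) * σ) := by
    simp only [Subgroup.coe_mul]; group
  have e2 : translation 2 = translation ((1 : ℤ) : ℝ) * translation ((1 : ℤ) : ℝ) := by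
    rw [← translation_add]; norm_num
  rw [e, e2]
  rcases h with h | h
  · rw [h]
  · rw [h, neg_mul_neg]

theorem tr_of_mem_pointStab (hσ : IsCuspScaling Γ 𝔞 σ) {γ : Γ} (hγ : γ ∈ pointStab Γ 𝔞) :
    tr γ = 2 ∨ tr γ = -2 := by
  obtain ⟨j, hj⟩ := exists_eq_translation hσ hγ
  have h1 : tr (σ⁻¹ * (γ : SL(2, ℝ)) * σ) = tr γ := by
    have := tr_conj σ⁻¹ (γ : SL(2, ℝ))
    rwa [inv_inv] at this
  rw [← h1]
  rcases hj with hj | hj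
  · left; rw [hj, tr]; simp; norm_num
  · right; rw [hj, tr_neg, tr]; simp; norm_num

/-- The identity is isolated in the conjugate of a discrete group. -/
theorem exists_isolating_radius (hΓ : DiscreteTopology Γ) (σ : SL(2, ℝ)) :
    ∃ ε > 0, ∀ γ : Γ, (∀ i j, |(σ⁻¹ * (γ : SL(2, ℝ)) * σ) i j - (1 : SL(2, ℝ)) i j| < ε) →
      γ = 1 := by
  have h1 : ({1} : Set Γ) ∈ nhds (1 : Γ) := by rw [nhds_discrete]; rfl
  rw [nhds_subtype, Filter.mem_comap] at h1
  obtain ⟨U, hU, hU1⟩ := h1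
  have hc : Continuous fun g : SL(2, ℝ) => σ * g * σ⁻¹ := by fun_prop
  have h2 : (fun g : SL(2, ℝ) => σ * g * σ⁻¹) ⁻¹' U ∈ nhds (1 : SL(2, ℝ)) := by
    apply hc.continuousAt
    simpa using hU
  obtain ⟨V, hV, hVU⟩ := (mem_nhds_induced (β := SL(2, ℝ)) Subtype.val 1 _).1 h2
  obtain ⟨ε, hε, hball⟩ := (Metric.mem_nhds_iff (α := Fin 2 → Fin 2 → ℝ)
    (x := ((1 : SL(2, ℝ)) : Matrix (Fin 2) (Fin 2) ℝ))).1 hV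
  refine ⟨ε, hε, fun γ hγ => ?_⟩
  have hmem : (σ⁻¹ * (γ : SL(2, ℝ)) * σ) ∈ (fun g : SL(2, ℝ) => σ * g * σ⁻¹) ⁻¹' U := by
    apply hVU
    apply hball
    refine Metric.mem_ball.2 ((dist_pi_lt_iff hε).2 fun i => (dist_pi_lt_iff hε).2 fun j => ?_)
    exact (Real.dist_eq _ _).trans_lt (hγ i j)
  apply hU1
  have e : σ * (σ⁻¹ * (γ : SL(2, ℝ)) * σ) * σ⁻¹ = γ := by group
  rw [Set.mem_preimage, e] at hmem
  exact hmem

/-- Shimizu's argument: for h with left column (a, c), the conjugate h T h⁻¹ of T = `translation 2`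
is 1 + 2(-ac, a²; -c², ac). If c is small and a has been reduced modulo 2c, this is close to 1,
hence equal to 1 by discreteness, which is absurd. -/
theorem exists_lower_left_bound (hΓ : DiscreteTopology Γ) (hσ : IsCuspScaling Γ 𝔞 σ) :
    ∃ δ > 0, ∀ γ : Γ, (σ⁻¹ * (γ : SL(2, ℝ)) * σ) 1 0 = 0 ∨
      δ ≤ |(σ⁻¹ * (γ : SL(2, ℝ)) * σ) 1 0| := by
  obtain ⟨ε, hε, hiso⟩ := exists_isolating_radius hΓ σ
  obtain ⟨t, ht⟩ := exists_mem_translation_two hσ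
  -- |c| < 1 gives c² ≤ |c|; the largest entry of the conjugate minus 1 is then 2a² ≤ 8|c|, which
  -- must be below ε.
  refine ⟨min 1 (ε / 9), by positivity, fun γ => ?_⟩
  by_contra! hcon
  obtain ⟨hc0, hcδ⟩ := hcon
  set g := σ⁻¹ * (γ : SL(2, ℝ)) * σ with hg
  set c := g 1 0 with hc
  have htz : ∀ j : ℤ, σ⁻¹ * ((t ^ j : Γ) : SL(2, ℝ)) * σ = translation 2 ^ j := by
    intro j
    have := conj_zpow (a := σ⁻¹) (b := (t : SL(2, ℝ))) (i := j)
    rw [inv_inv, ht] at this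
    rw [this, Subgroup.coe_zpow]
  have htp : ∀ j : ℤ, translation 2 ^ j = translation (2 * j) := by
    intro j
    induction j with
    | zero => apply ext_entries <;> simp
    | succ j ih => rw [zpow_add_one, ih, ← translation_add]; push_cast; ring_nf
    | pred j ih =>
      rw [zpow_sub_one, ih, mul_inv_eq_iff_eq_mul, ← translation_add]; push_cast; ring_nf
  -- Left translation by 2j replaces a by a + 2jc, leaving 2c times a fractional part.
  set j : ℤ := -⌊g 0 0 / (2 * c)⌋ with hj
  set γ' : Γ := t ^ j * γ with hγ'
  have hg' : σ⁻¹ * (γ' : SL(2, ℝ)) * σ = translation (2 * j) * g := by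
    rw [← htp, ← htz, hg, hγ']
    simp only [Subgroup.coe_mul]; group
  set a' := g 0 0 + 2 * j * c with ha'
  have ha'b : |a'| ≤ 2 * |c| := by
    have h1 : a' = 2 * c * Int.fract (g 0 0 / (2 * c)) := by
      rw [ha', hj, Int.fract]
      push_cast
      field_simp
      ring
    rw [h1, abs_mul, abs_mul, abs_two, abs_of_nonneg (Int.fract_nonneg (g 0 0 / (2 * c)))]
    have := (Int.fract_lt_one (g 0 0 / (2 * c))).le
    nlinarith [abs_nonneg c]
  have hconj : σ⁻¹ * ((γ' * t * γ'⁻¹ : Γ) : SL(2, ℝ)) * σ =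
      (translation (2 * j) * g) * translation 2 * (translation (2 * j) * g)⁻¹ := by
    rw [← hg', ← ht]
    simp only [Subgroup.coe_mul, Subgroup.coe_inv]; group
  set h := translation (2 * j) * g with hh
  have e00 : h 0 0 = a' := by simp [hh, mul_entry, ha', hc]
  have e10 : h 1 0 = c := by simp [hh, mul_entry, hc]
  have hdet := det_entries h
  have hc1 : |c| < 1 := hcδ.trans_le (min_le_left _ _)
  have hc2 : |c| < ε / 9 := hcδ.trans_le (min_le_right _ _)
  have hcpos : 0 < |c| := abs_pos.2 hc0
  have b1 : |a'| * |c| ≤ 2 * |c| := by nlinarith [abs_nonneg a']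
  have b2 : |a'| * |a'| ≤ 4 * |c| := by nlinarith [abs_nonneg a']
  have b3 : |c| * |c| ≤ |c| := by nlinarith
  have hone : γ' * t * γ'⁻¹ = 1 := by
    apply hiso
    intro i k
    rw [hconj]
    have f00 : (h * translation 2 * h⁻¹) 0 0 - 1 = -2 * (a' * c) := by
      simp only [mul_entry, inv_00, inv_10, translation_00, translation_01,
        translation_10, translation_11]
      rw [← e00, ← e10]; linear_combination hdet
    have f01 : (h * translation 2 * h⁻¹) 0 1 = 2 * (a' * a') := by
      simp only [mul_entry, inv_01, inv_11, translation_00, translation_01,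
        translation_10, translation_11]
      rw [← e00]; ring
    have f10 : (h * translation 2 * h⁻¹) 1 0 = -2 * (c * c) := by
      simp only [mul_entry, inv_00, inv_10, translation_00, translation_01,
        translation_10, translation_11]
      rw [← e10]; ring
    have f11 : (h * translation 2 * h⁻¹) 1 1 - 1 = 2 * (a' * c) := by
      simp only [mul_entry, inv_01, inv_11, translation_00, translation_01,
        translation_10, translation_11]
      rw [← e00, ← e10]; linear_combination hdet
    fin_cases i <;> fin_cases k
    · simp only [Fin.zero_eta, Fin.isValue, Matrix.SpecialLinearGroup.coe_one, Matrix.one_apply_eq]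
      rw [f00, abs_mul, abs_mul]; norm_num; linarith
    · simp only [Fin.zero_eta, Fin.isValue, Fin.mk_one, Matrix.SpecialLinearGroup.coe_one, ne_eq,
        zero_ne_one, not_false_eq_true, Matrix.one_apply_ne, sub_zero]
      rw [f01, abs_mul, abs_mul]; norm_num; linarith [abs_mul_abs_self a']
    · simp only [Fin.zero_eta, Fin.isValue, Fin.mk_one, Matrix.SpecialLinearGroup.coe_one, ne_eq,
        one_ne_zero, not_false_eq_true, Matrix.one_apply_ne, sub_zero]
      rw [f10, abs_mul, abs_mul]; norm_num; linarith [abs_mul_abs_self c]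
    · simp only [Fin.mk_one, Fin.isValue, Matrix.SpecialLinearGroup.coe_one, Matrix.one_apply_eq]
      rw [f11, abs_mul, abs_mul]; norm_num; linarith
  have ht1 : t = 1 := by
    have := congrArg (fun x => γ'⁻¹ * x * γ') hone
    simpa [mul_assoc] using this
  have := congrArg (fun x : SL(2, ℝ) => x 0 1) ht
  simp [ht1] at this

theorem cuspCosets_out_ne {p p' : CuspCosets Γ 𝔞} (hne : p ≠ p') :
    (p'.out * p.out⁻¹ : Γ) ∉ pointStab Γ 𝔞 := by
  intro h
  apply hne
  rw [← p.out_eq, ← p'.out_eq]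
  exact Quotient.sound (QuotientGroup.rightRel_apply.2 h)

/-- The lower rows belonging to distinct cosets of the stabilizer of a cusp span parallelograms of
area bounded below. -/
theorem exists_wedge_bound (hΓ : DiscreteTopology Γ) (hσ : IsCuspScaling Γ 𝔞 σ) :
    ∃ δ > 0, ∀ (τ : SL(2, ℝ)) (p p' : CuspCosets Γ 𝔞), p ≠ p' →
      δ ≤ |(σ⁻¹ * (p.out : Γ) * τ : SL(2, ℝ)) 1 0 * (σ⁻¹ * (p'.out : Γ) * τ : SL(2, ℝ)) 1 1 -
        (σ⁻¹ * (p.out : Γ) * τ : SL(2, ℝ)) 1 1 * (σ⁻¹ * (p'.out : Γ) * τ : SL(2, ℝ)) 1 0| := by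
  obtain ⟨δ, hδ, hb⟩ := exists_lower_left_bound hΓ hσ
  refine ⟨δ, hδ, fun τ p p' hne => ?_⟩
  have h1 := cuspCosets_out_ne hne
  rw [mem_pointStab_iff hσ] at h1
  have h2 := (hb _).resolve_left h1
  set M := σ⁻¹ * (p.out : Γ) * τ
  set M' := σ⁻¹ * (p'.out : Γ) * τ
  -- Up to sign, the wedge of the two lower rows is the lower left entry of M' M⁻¹, in which τ
  -- cancels.
  have e : σ⁻¹ * ((p'.out * p.out⁻¹ : Γ) : SL(2, ℝ)) * σ = M' * M⁻¹ := by
    simp only [M, M', Subgroup.coe_mul, Subgroup.coe_inv]; group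
  rw [e, mul_entry, inv_00, inv_10] at h2
  rw [abs_sub_comm]
  convert h2 using 2
  ring

end Cusp

/-! ### The stabilizer of a hyperbolic pair and the parametrization of Γ_𝔞\Γ. -/

section HyperbolicPair

theorem exists_eq_dilation (hη : IsHyperbolicScaling Γ η₁ η₂ ση ℓ) {γ : Γ}
    (hγ : γ ∈ pairStab Γ η₁ η₂) :
    ∃ j : ℤ, ση⁻¹ * (γ : SL(2, ℝ)) * ση = dilation (j * ℓ) ∨
      ση⁻¹ * (γ : SL(2, ℝ)) * ση = -dilation (j * ℓ) := by
  have : ση⁻¹ * (γ : SL(2, ℝ)) * ση ∈ signedConj (pairStab Γ η₁ η₂) ση := ⟨γ, hγ, Or.inl rfl⟩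
  rwa [hη.conj_eq] at this

theorem exists_generator (hη : IsHyperbolicScaling Γ η₁ η₂ ση ℓ) :
    ∃ γ ∈ pairStab Γ η₁ η₂, ση⁻¹ * (γ : SL(2, ℝ)) * ση = dilation ℓ ∨
      ση⁻¹ * (γ : SL(2, ℝ)) * ση = -dilation ℓ := by
  have : dilation ((1 : ℤ) * ℓ) ∈ signedConj (pairStab Γ η₁ η₂) ση := by
    rw [hη.conj_eq]; exact ⟨1, Or.inl rfl⟩
  obtain ⟨γ, hγ, h⟩ := this
  refine ⟨γ, hγ, ?_⟩
  rw [Int.cast_one, one_mul] at h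
  rcases h with h | h
  · exact Or.inl h.symm
  · exact Or.inr (by rw [h, neg_neg])

/-- A generator, up to sign, of the stabilizer of a hyperbolic pair. -/
def generator (hη : IsHyperbolicScaling Γ η₁ η₂ ση ℓ) : Γ := (exists_generator hη).choose

theorem generator_mem (hη : IsHyperbolicScaling Γ η₁ η₂ ση ℓ) :
    generator hη ∈ pairStab Γ η₁ η₂ := (exists_generator hη).choose_spec.1

theorem generator_zpow_conj (hη : IsHyperbolicScaling Γ η₁ η₂ ση ℓ) (j : ℤ) :
    ση⁻¹ * ((generator hη ^ j : Γ) : SL(2, ℝ)) * ση = dilation (j * ℓ) ∨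
      ση⁻¹ * ((generator hη ^ j : Γ) : SL(2, ℝ)) * ση = -dilation (j * ℓ) := by
  have hz : ση⁻¹ * ((generator hη ^ j : Γ) : SL(2, ℝ)) * ση =
      (ση⁻¹ * (generator hη : SL(2, ℝ)) * ση) ^ j := by
    have := conj_zpow (a := ση⁻¹) (b := (generator hη : SL(2, ℝ))) (i := j)
    rw [inv_inv] at this
    rw [this, Subgroup.coe_zpow]
  have h := (exists_generator hη).choose_spec.2
  change ση⁻¹ * (generator hη : SL(2, ℝ)) * ση = _ ∨
    ση⁻¹ * (generator hη : SL(2, ℝ)) * ση = _ at h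
  rw [hz]
  clear hz
  set A := ση⁻¹ * (generator hη : SL(2, ℝ)) * ση
  have step : ∀ x y : SL(2, ℝ), ∀ s t : ℝ, (x = dilation s ∨ x = -dilation s) →
      (y = dilation t ∨ y = -dilation t) →
      (x * y = dilation (s + t) ∨ x * y = -dilation (s + t)) := by
    rintro x y s t (rfl | rfl) (rfl | rfl) <;> rw [dilation_add] <;> simp
  have hinv : A⁻¹ = dilation (-ℓ) ∨ A⁻¹ = -dilation (-ℓ) := by
    rw [dilation_neg]
    rcases h with h | h
    · left; rw [h]
    · right; rw [h, inv_neg]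
  induction j with
  | zero => left; simp [dilation_zero]
  | succ j ih =>
    have := step _ _ _ _ ih h
    rw [zpow_add_one, show ((j + 1 : ℤ) : ℝ) * ℓ = (j : ℤ) * ℓ + ℓ by push_cast; ring]
    exact this
  | pred j ih =>
    have := step _ _ _ _ ih hinv
    rw [zpow_sub_one, show ((-j - 1 : ℤ) : ℝ) * ℓ = ((-j : ℤ) : ℝ) * ℓ + -ℓ by push_cast; ring]
    exact this

/-- Trace comparison: ±2 for elements fixing the cusp, ±2 cosh(jℓ/2) for conjugates of powers of the
generator. -/
theorem generator_conj_notMem (hσ : IsCuspScaling Γ 𝔞 σ)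
    (hη : IsHyperbolicScaling Γ η₁ η₂ ση ℓ) (γ : Γ) {j : ℤ}
    (h : γ * generator hη ^ j * γ⁻¹ ∈ pointStab Γ 𝔞) : j = 0 := by
  have h1 := tr_of_mem_pointStab hσ h
  simp only [Subgroup.coe_mul, Subgroup.coe_inv] at h1
  rw [tr_conj] at h1
  have h2 := tr_conj ση⁻¹ ((generator hη ^ j : Γ) : SL(2, ℝ))
  rw [inv_inv] at h2
  rw [← h2] at h1
  have h3 : tr (dilation (j * ℓ)) = 2 ∨ tr (dilation (j * ℓ)) = -2 := by
    rcases generator_zpow_conj hη j with h4 | h4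
    · rwa [h4] at h1
    · rw [h4, tr_neg] at h1
      rcases h1 with h1 | h1
      · right; linarith
      · left; linarith
  have := tr_dilation_eq_two h3
  have hl := hη.length_pos
  simpa [hl.ne'] using this

/-- The lower left entry of M `dilation x` M⁻¹ is a multiple of cd. If cd = 0, a conjugate of the
generator would fix the cusp. -/
theorem lowerProd_ne_zero (hσ : IsCuspScaling Γ 𝔞 σ)
    (hη : IsHyperbolicScaling Γ η₁ η₂ ση ℓ) (γ : Γ) :
    lowerProd (σ⁻¹ * (γ : SL(2, ℝ)) * ση) ≠ 0 := by
  intro h0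
  suffices (1 : ℤ) = 0 by norm_num at this
  apply generator_conj_notMem hσ hη γ
  rw [mem_pointStab_iff hσ]
  set M := σ⁻¹ * (γ : SL(2, ℝ)) * ση with hM
  have e : σ⁻¹ * ((γ * generator hη ^ (1 : ℤ) * γ⁻¹ : Γ) : SL(2, ℝ)) * σ =
      M * (ση⁻¹ * ((generator hη ^ (1 : ℤ) : Γ) : SL(2, ℝ)) * ση) * M⁻¹ := by
    simp only [hM, Subgroup.coe_mul, Subgroup.coe_inv]; group
  have e2 : ∀ x : ℝ, (M * dilation x * M⁻¹) 1 0 = 0 := by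
    intro x
    simp only [mul_entry, inv_00, inv_10, dilation_00, dilation_01, dilation_10, dilation_11]
    rw [lowerProd] at h0
    linear_combination (Real.exp (x / 2) - Real.exp (-(x / 2))) * h0
  rw [e]
  rcases generator_zpow_conj hη 1 with h | h
  · rw [h, e2]
  · rw [h, mul_neg, neg_mul, neg_entry, e2, neg_zero]

/-- The coset `Γ_𝔞 γ δ ^ j`, where `γ` represents the double coset `q` and `δ` generates the
stabilizer of the hyperbolic pair. -/
def cosetOf (hη : IsHyperbolicScaling Γ η₁ η₂ ση ℓ) (x : DoubleCosets Γ 𝔞 η₁ η₂ × ℤ) :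
    CuspCosets Γ 𝔞 :=
  Quotient.mk _ ((Quotient.out x.1 : Γ) * generator hη ^ x.2)

theorem cosetOf_injective (hσ : IsCuspScaling Γ 𝔞 σ) (hη : IsHyperbolicScaling Γ η₁ η₂ ση ℓ) :
    Function.Injective (cosetOf (𝔞 := 𝔞) hη) := by
  rintro ⟨q, j⟩ ⟨q', j'⟩ h
  have h1 := QuotientGroup.rightRel_apply.1 (Quotient.exact h)
  simp only at h1
  have hq : q = q' := by
    rw [← DoubleCoset.out_eq' _ _ q, ← DoubleCoset.out_eq' _ _ q', DoubleCoset.eq]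
    refine ⟨_, h1, generator hη ^ (j - j'),
      Subgroup.zpow_mem _ (generator_mem hη) _, ?_⟩
    rw [zpow_sub]; group
  subst hq
  have : j' - j = 0 := by
    apply generator_conj_notMem hσ hη (Quotient.out q)
    convert h1 using 1
    rw [zpow_sub]; group
  rw [Prod.mk.injEq]
  exact ⟨rfl, by omega⟩

/-- Γ_η consists of powers of the generator only up to sign. The sign does no harm, since membership
in Γ_𝔞 is the vanishing of an entry. -/
theorem cosetOf_surjective (hσ : IsCuspScaling Γ 𝔞 σ) (hη : IsHyperbolicScaling Γ η₁ η₂ ση ℓ) :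
    Function.Surjective (cosetOf (𝔞 := 𝔞) hη) := by
  intro p
  induction p using Quotient.inductionOn with | h γ => ?_
  obtain ⟨h, k, hh, hk, e⟩ := DoubleCoset.mk_out_eq_mul (pointStab Γ 𝔞) (pairStab Γ η₁ η₂) γ
  obtain ⟨j, hj⟩ := exists_eq_dilation hη (inv_mem hk)
  refine ⟨(DoubleCoset.mk _ _ γ, j), Quotient.sound (QuotientGroup.rightRel_apply.2 ?_)⟩
  simp only
  rw [e]
  have hsign : ((k * generator hη ^ j : Γ) : SL(2, ℝ)) = 1 ∨
      ((k * generator hη ^ j : Γ) : SL(2, ℝ)) = -1 := by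
    have hj' := generator_zpow_conj hη j
    have : ση⁻¹ * ((generator hη ^ j : Γ) : SL(2, ℝ)) * ση = ση⁻¹ * ((k⁻¹ : Γ) : SL(2, ℝ)) * ση ∨
        ση⁻¹ * ((generator hη ^ j : Γ) : SL(2, ℝ)) * ση =
          -(ση⁻¹ * ((k⁻¹ : Γ) : SL(2, ℝ)) * ση) := by
      rcases hj with hj | hj <;> rcases hj' with hj' | hj' <;> rw [hj, hj'] <;> simp
    rw [Subgroup.coe_mul]
    rcases this with h | h
    · left
      rw [mul_left_inj, mul_right_inj] at h
      rw [h]; simp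
    · right
      rw [← neg_mul, ← mul_neg, mul_left_inj, mul_right_inj] at h
      rw [h]; simp
  rw [mem_pointStab_iff hσ] at hh ⊢
  have hh' : h ∈ pointStab Γ 𝔞 := (mem_pointStab_iff hσ h).2 hh
  have hinv := (mem_pointStab_iff hσ _).1 (inv_mem hh')
  have e3 : σ⁻¹ * ((γ * (h * γ * k * generator hη ^ j)⁻¹ : Γ) : SL(2, ℝ)) * σ =
      σ⁻¹ * ((γ : SL(2, ℝ)) * (((k * generator hη ^ j : Γ) : SL(2, ℝ)))⁻¹ * (γ : SL(2, ℝ))⁻¹ *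
        ((h⁻¹ : Γ) : SL(2, ℝ))) * σ := by
    simp only [Subgroup.coe_mul, Subgroup.coe_inv]; group
  rw [e3]
  rcases hsign with h1 | h1
  · rw [h1]; simpa using hinv
  · rw [h1]
    simpa [neg_entry] using hinv

end HyperbolicPair

end

section

/-! ### Counting separated vectors in the plane. -/

section SeparatedRows

variable {ι : Type*} {c d : ι → ℝ} {δ : ℝ}

/-- The slopes c/d lie in [-1, 1] and differ pairwise by at least δ/|d d'| ≥ δ/X. So the floors of
(X/δ) c/d are distinct; they lie between -N - 1 and N, which are 2N + 2 values. -/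
theorem card_le_of_slope_separated (hδ : 0 < δ) {X : ℝ} (hX : 0 < X) (s : Finset ι)
    (h : ∀ i ∈ s, ∀ j ∈ s, i ≠ j → δ ≤ |c i * d j - d i * c j|)
    (hcd : ∀ i ∈ s, |c i| ≤ |d i|) (hd0 : ∀ i ∈ s, d i ≠ 0) (hdX : ∀ i ∈ s, d i ^ 2 ≤ X) :
    (s.card : ℝ) ≤ 2 * (X / δ) + 2 := by
  set N : ℤ := ⌊X / δ⌋ with hN
  have hXδ : 0 < X / δ := by positivity
  have hN0 : 0 ≤ N := Int.floor_nonneg.2 hXδ.le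
  let f : ι → ℤ := fun i => ⌊c i / d i * (X / δ)⌋
  have hmaps : ∀ i ∈ s, f i ∈ Finset.Icc (-N - 1) N := by
    intro i hi
    have h1 : |c i / d i| ≤ 1 := by
      rw [abs_div]; exact div_le_one_of_le₀ (hcd i hi) (abs_nonneg _)
    rw [abs_le] at h1
    rw [Finset.mem_Icc]
    constructor
    · rw [Int.le_floor]
      have := (Int.lt_floor_add_one (X / δ)).le
      push_cast
      nlinarith
    · apply Int.floor_le_floor
      nlinarith
  have hinj : Set.InjOn f s := by
    intro i hi j hj hij
    by_contra hne
    have h1 := h i hi j hj hne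
    have h2 := Int.abs_sub_lt_one_of_floor_eq_floor hij
    have h3 : |c i / d i * (X / δ) - c j / d j * (X / δ)| =
        |c i * d j - d i * c j| * X / (|d i| * |d j| * δ) := by
      have e1 : c i / d i * (X / δ) - c j / d j * (X / δ) =
          (c i * d j - d i * c j) * X / (d i * d j * δ) := by
        have := hd0 i hi
        have := hd0 j hj
        field_simp
      rw [e1, abs_div, abs_mul, abs_mul, abs_mul, abs_of_pos hX, abs_of_pos hδ]
    have hpi := abs_pos.2 (hd0 i hi)
    have hpj := abs_pos.2 (hd0 j hj)
    rw [h3, div_lt_one (by positivity)] at h2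
    have h4 : |d i| * |d j| ≤ X := by
      have e1 := hdX i hi
      have e2 := hdX j hj
      rw [← sq_abs] at e1 e2
      nlinarith [sq_nonneg (|d i| - |d j|)]
    nlinarith
  have h5 := Finset.card_le_card_of_injOn f hmaps hinj
  rw [Int.card_Icc] at h5
  have h6 : (s.card : ℤ) ≤ 2 * N + 2 := by omega
  have h7 : (s.card : ℝ) ≤ 2 * N + 2 := by exact_mod_cast h6
  have h8 : (N : ℝ) ≤ X / δ := Int.floor_le _
  linarith

/-- The number of separated rows in a disc of radius `√X` is `O(X)`. -/
theorem card_le_of_separated (hδ : 0 < δ) (h0 : ∀ i, c i ≠ 0 ∨ d i ≠ 0)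
    (h : ∀ i j, i ≠ j → δ ≤ |c i * d j - d i * c j|) {X : ℝ} (hX : 0 < X) (s : Finset ι)
    (hs : ∀ i ∈ s, c i ^ 2 + d i ^ 2 ≤ X) : (s.card : ℝ) ≤ 4 * (X / δ) + 4 := by
  classical
  -- Rows with |c| > |d| are counted with the two coordinates exchanged, which doubles the bound.
  have h1 := card_le_of_slope_separated (c := c) (d := d) hδ hX (s.filter fun i => |c i| ≤ |d i|)
    (fun i _ j _ hij => h i j hij) (fun i hi => (Finset.mem_filter.1 hi).2)
    (fun i hi hd => by
      have h2 := (Finset.mem_filter.1 hi).2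
      rw [hd, abs_zero] at h2
      exact (h0 i).elim (fun h => h (abs_nonpos_iff.1 h2)) fun h => h hd)
    (fun i hi => by
      have := hs i (Finset.mem_filter.1 hi).1
      nlinarith [sq_nonneg (c i)])
  have h2 := card_le_of_slope_separated (c := d) (d := c) hδ hX
    (s.filter fun i => ¬ |c i| ≤ |d i|)
    (fun i _ j _ hij => by
      have := h i j hij
      rw [abs_sub_comm] at this
      linarith)
    (fun i hi => (not_le.1 (Finset.mem_filter.1 hi).2).le)
    (fun i hi hc => by
      have h2 := (Finset.mem_filter.1 hi).2
      rw [hc, abs_zero] at h2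
      exact h2 (abs_nonneg _))
    (fun i hi => by
      have := hs i (Finset.mem_filter.1 hi).1
      nlinarith [sq_nonneg (d i)])
  have h3 := Finset.card_filter_add_card_filter_not (s := s) (fun i => |c i| ≤ |d i|)
  rw [← h3]
  push_cast
  linarith

/-- Dyadic decomposition by the size of c² + d²: level n has O(2^n) rows, and for n ≥ 1 each
contributes at most 4^(-n). -/
theorem summable_of_separated (hδ : 0 < δ) (h0 : ∀ i, c i ≠ 0 ∨ d i ≠ 0)
    (h : ∀ i j, i ≠ j → δ ≤ |c i * d j - d i * c j|) :
    Summable fun i => ((c i ^ 2 + d i ^ 2)⁻¹) ^ 2 := by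
  set a : ι → ℝ := fun i => c i ^ 2 + d i ^ 2 with ha
  have hapos : ∀ i, 0 < a i := by
    intro i
    rcases h0 i with h | h <;> positivity
  let lev : ι → ℕ := fun i => Nat.log 2 ⌊a i⌋₊
  have hup : ∀ i n, lev i = n → a i ≤ 2 ^ (n + 1) := by
    intro i n hi
    have h1 : ⌊a i⌋₊ + 1 ≤ 2 ^ (n + 1) := by
      rw [← hi]; exact Nat.lt_pow_succ_log_self one_lt_two _
    have h2 := (Nat.lt_floor_add_one (a i)).le
    refine h2.trans ?_
    exact_mod_cast h1
  have hlow : ∀ i n, lev i = n + 1 → 2 ^ (n + 1) ≤ a i := by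
    intro i n hi
    have hne : ⌊a i⌋₊ ≠ 0 := by
      intro h0
      simp only [lev, h0, Nat.log_zero_right] at hi
      omega
    have h1 : 2 ^ (n + 1) ≤ ⌊a i⌋₊ := by
      rw [← hi]; exact Nat.pow_log_le_self 2 hne
    refine le_trans ?_ (Nat.floor_le (hapos i).le)
    exact_mod_cast h1
  have hcard : ∀ n, ∀ s : Finset ι, (∀ i ∈ s, lev i = n) →
      (s.card : ℝ) ≤ 4 * (2 ^ (n + 1) / δ) + 4 := fun n s hs =>
    card_le_of_separated hδ h0 h (by positivity) s fun i hi => hup i n (hs i hi)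
  have hfin : ∀ n, {i | lev i = n}.Finite := by
    intro n
    by_contra hinf
    obtain ⟨s, hs, hsc⟩ := Set.Infinite.exists_subset_card_eq hinf
      (⌊4 * ((2 : ℝ) ^ (n + 1) / δ) + 4⌋₊ + 1)
    have h1 := hcard n s fun i hi => hs hi
    rw [hsc] at h1
    have := Nat.lt_floor_add_one (4 * ((2 : ℝ) ^ (n + 1) / δ) + 4)
    push_cast at h1
    linarith
  rw [summable_partition (s := fun n => {i | lev i = n}) (fun i => by positivity)
    (fun i => ⟨lev i, rfl, fun j hj => hj.symm⟩)]
  refine ⟨fun n => ?_, ?_⟩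
  · have := (hfin n).to_subtype
    exact Summable.of_finite
  -- Since `Nat.log 2 0 = 0`, level 0 also contains the rows with c² + d² < 1, for which the lower
  -- bound fails. This single finite level is dropped.
  rw [← summable_nat_add_iff 1]
  have hgeo : Summable fun n : ℕ => (4 / δ + 4) * (1 / 2 : ℝ) ^ n :=
    (summable_geometric_of_lt_one (by norm_num) (by norm_num)).mul_left _
  refine Summable.of_nonneg_of_le (fun n => tsum_nonneg fun i => by positivity) (fun n => ?_) hgeo
  have : Fintype {i | lev i = n + 1} := (hfin (n + 1)).fintype
  rw [tsum_fintype]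
  have h1 : ∀ i : {i | lev i = n + 1}, ((a i)⁻¹) ^ 2 ≤ ((2 : ℝ) ^ (n + 1))⁻¹ ^ 2 := by
    intro i
    have := hlow i n i.2
    gcongr
  refine (Finset.sum_le_card_nsmul _ _ _ fun i _ => h1 i).trans ?_
  rw [nsmul_eq_mul]
  have h2 := hcard (n + 1) {i | lev i = n + 1}.toFinset fun i hi => by simpa using hi
  rw [Set.toFinset_card] at h2
  rw [Finset.card_univ]
  refine (mul_le_mul_of_nonneg_right h2 (by positivity)).trans ?_
  rw [one_div, inv_pow, inv_pow]
  have h3 : (1 : ℝ) ≤ 2 ^ n := one_le_pow₀ (by norm_num)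
  rw [← div_eq_mul_inv, ← div_eq_mul_inv, div_le_div_iff₀ (by positivity) (by positivity)]
  have e : (2 : ℝ) ^ (n + 1 + 1) = 4 * 2 ^ n := by ring
  have e' : ((2 : ℝ) ^ (n + 1)) ^ 2 = 4 * 2 ^ n * 2 ^ n := by ring
  rw [e, e']
  have h4 : (4 * (4 * 2 ^ n / δ) + 4) ≤ (4 / δ + 4) * (4 * (2 : ℝ) ^ n) := by
    have : 4 * (4 * 2 ^ n / δ) = 4 / δ * (4 * (2 : ℝ) ^ n) := by field_simp
    nlinarith
  nlinarith [pow_pos (two_pos (α := ℝ)) n]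

end SeparatedRows

theorem lower_row_ne_zero (g : SL(2, ℝ)) : g 1 0 ≠ 0 ∨ g 1 1 ≠ 0 := by
  by_contra! h
  have := det_entries g
  rw [h.1, h.2] at this
  norm_num at this

/-- The squared length of the lower row. -/
def rowSq (g : SL(2, ℝ)) : ℝ := g 1 0 ^ 2 + g 1 1 ^ 2

theorem rowSq_pos (g : SL(2, ℝ)) : 0 < rowSq g := by
  rw [rowSq]
  rcases lower_row_ne_zero g with h | h <;> positivity

theorem summable_rowSq {Γ : Subgroup SL(2, ℝ)} {𝔞 : OnePoint ℝ} {σ : SL(2, ℝ)}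
    (hΓ : DiscreteTopology Γ) (hσ : IsCuspScaling Γ 𝔞 σ) (τ : SL(2, ℝ)) :
    Summable fun p : CuspCosets Γ 𝔞 => ((rowSq (σ⁻¹ * (p.out : Γ) * τ))⁻¹) ^ 2 := by
  obtain ⟨δ, hδ, h⟩ := exists_wedge_bound hΓ hσ
  exact summable_of_separated hδ (fun p => lower_row_ne_zero _) (h τ)

/-! ### Size of a single term of the Poincaré series. -/

section SlashTerm

/-- The value at `z` of `e(m ·) |_k M`. -/
def slashTerm (k : ℕ) (m : ℤ) (M : SL(2, ℝ)) (z : ℂ) : ℂ :=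
  e (m * ((M 0 0 * z + M 0 1) / (M 1 0 * z + M 1 1))) / (M 1 0 * z + M 1 1) ^ k

theorem denom_ne_zero (M : SL(2, ℝ)) {z : ℂ} (hz : 0 < z.im) : (M 1 0 * z + M 1 1 : ℂ) ≠ 0 := by
  intro h
  have h1 := congrArg Complex.im h
  have h2 := congrArg Complex.re h
  simp at h1 h2
  rcases h1 with h1 | h1
  · rw [h1] at h2
    have := lower_row_ne_zero M
    simp_all
  · exact hz.ne' h1

theorem norm_e (z : ℂ) : ‖e z‖ = Real.exp (-(2 * Real.pi * z.im)) := by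
  rw [e, Complex.norm_exp]
  simp

theorem im_moebius (M : SL(2, ℝ)) (z : ℂ) :
    ((M 0 0 * z + M 0 1) / (M 1 0 * z + M 1 1) : ℂ).im =
      z.im / Complex.normSq (M 1 0 * z + M 1 1) := by
  have hdet := det_entries M
  rw [Complex.div_im]
  simp only [Complex.add_im, Complex.mul_im, Complex.ofReal_re, Complex.ofReal_im, zero_mul,
    add_zero, Complex.add_re, Complex.mul_re, sub_zero]
  rw [← sub_div]
  congr 1
  linear_combination z.im * hdet

/-- With w = cz + d, both c = Im w / Im z and d = w - cz are controlled by |w|. -/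
theorem rowSq_le (M : SL(2, ℝ)) {z : ℂ} {B y : ℝ} (hB : ‖z‖ ≤ B) (hy : 0 < y) (hyz : y ≤ z.im) :
    rowSq M ≤ ((1 / y) ^ 2 + (1 + B / y) ^ 2) * ‖(M 1 0 * z + M 1 1 : ℂ)‖ ^ 2 := by
  set w : ℂ := M 1 0 * z + M 1 1 with hw
  have hB0 : 0 ≤ B := (norm_nonneg z).trans hB
  have h1 : |M 1 0| * y ≤ ‖w‖ := by
    have := Complex.abs_im_le_norm w
    have e : w.im = M 1 0 * z.im := by simp [hw]
    rw [e, abs_mul, abs_of_pos (hy.trans_le hyz)] at this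
    exact (mul_le_mul_of_nonneg_left hyz (abs_nonneg _)).trans this
  have h1' : |M 1 0| ≤ 1 / y * ‖w‖ := by
    rw [one_div, inv_mul_eq_div, le_div_iff₀ hy]; exact h1
  have h2 : |M 1 1| ≤ (1 + B / y) * ‖w‖ := by
    have e : ((M 1 1 : ℝ) : ℂ) = w - M 1 0 * z := by rw [hw]; ring
    calc |M 1 1| = ‖((M 1 1 : ℝ) : ℂ)‖ := by rw [Complex.norm_real, Real.norm_eq_abs]
      _ ≤ ‖w‖ + |M 1 0| * ‖z‖ := by
        rw [e]; refine (norm_sub_le _ _).trans ?_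
        rw [norm_mul, Complex.norm_real, Real.norm_eq_abs]
      _ ≤ ‖w‖ + (1 / y * ‖w‖) * B := by gcongr
      _ = _ := by ring
  rw [rowSq, ← sq_abs (M 1 0), ← sq_abs (M 1 1), add_mul, ← mul_pow, ← mul_pow]
  gcongr

/-- On the set of all `z` with `|z| ≤ B` and `Im z ≥ y`, the terms of a Poincaré series are
uniformly dominated by `(c ^ 2 + d ^ 2)⁻²`, as long as the lower rows `(c, d)` stay away from `0`. -/
theorem exists_slashTerm_bound {k : ℕ} (hk : Even k) (hk4 : 4 ≤ k) (m : ℤ) {B y R : ℝ}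
    (hB : 0 ≤ B) (hy : 0 < y) (hR : 0 ≤ R) :
    ∃ K : ℝ, 0 ≤ K ∧ ∀ (M : SL(2, ℝ)) (z : ℂ), (rowSq M)⁻¹ ≤ R → ‖z‖ ≤ B → y ≤ z.im →
      ‖slashTerm k m M z‖ ≤ K * ((rowSq M)⁻¹) ^ 2 := by
  set A := (1 / y) ^ 2 + (1 + B / y) ^ 2 with hA
  have hApos : 0 < A := by positivity
  obtain ⟨l, rfl⟩ := hk
  obtain ⟨l, rfl⟩ : ∃ l', l = l' + 2 := ⟨l - 2, by omega⟩
  -- Here k = 2l + 4: the factor |w|⁻⁴ yields the square of the inverse row length, and the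
  -- remaining |w|^(-2l) is bounded. The exponential factor is needed for m < 0 and uses Im(Mz) = Im
  -- z / |w|² ≤ B A R.
  refine ⟨Real.exp (2 * Real.pi * |(m : ℝ)| * (B * (A * R))) * (A ^ 2 * (A * R) ^ l),
    by positivity, fun M z hM hzB hyz => ?_⟩
  have hz : 0 < z.im := hy.trans_le hyz
  have hrow := rowSq_le M hzB hy hyz
  rw [← hA] at hrow
  set w : ℂ := M 1 0 * z + M 1 1 with hw
  have hw0 : w ≠ 0 := denom_ne_zero M hz
  have hwn : 0 < ‖w‖ := norm_pos_iff.2 hw0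
  have hrp := rowSq_pos M
  have h1 : (‖w‖ ^ 2)⁻¹ ≤ A * (rowSq M)⁻¹ := by
    rw [← div_eq_mul_inv, inv_le_comm₀ (by positivity) (by positivity), inv_div,
      div_le_iff₀ hApos]
    linarith
  have h2 : (‖w‖ ^ 2)⁻¹ ≤ A * R := h1.trans (by gcongr)
  rw [slashTerm, norm_div, norm_pow, norm_e, div_eq_mul_inv, mul_assoc (Real.exp _)]
  gcongr
  · have e : ((m : ℂ) * ((M 0 0 * z + M 0 1) / w)).im =
        m * ((M 0 0 * z + M 0 1) / w : ℂ).im := by simp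
    rw [e, im_moebius M z, ← hw, Complex.normSq_eq_norm_sq, div_eq_mul_inv]
    have h3 : z.im * (‖w‖ ^ 2)⁻¹ ≤ B * (A * R) := by
      have : z.im ≤ B := (Complex.abs_im_le_norm z |>.trans' (le_abs_self _)).trans hzB
      gcongr
    have h4 : -(m : ℝ) * (z.im * (‖w‖ ^ 2)⁻¹) ≤ |(m : ℝ)| * (B * (A * R)) := by
      have h5 : 0 ≤ z.im * (‖w‖ ^ 2)⁻¹ := by positivity
      have h6 := neg_abs_le (m : ℝ)
      nlinarith [abs_nonneg (m : ℝ)]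
    have := Real.pi_pos
    nlinarith
  · have e : (‖w‖ ^ (l + 2 + (l + 2)))⁻¹ = (‖w‖ ^ 2)⁻¹ ^ 2 * (‖w‖ ^ 2)⁻¹ ^ l := by
      rw [← pow_add, inv_pow, ← pow_mul]; congr 2; ring
    rw [e]
    calc (‖w‖ ^ 2)⁻¹ ^ 2 * (‖w‖ ^ 2)⁻¹ ^ l ≤ (A * (rowSq M)⁻¹) ^ 2 * (A * R) ^ l := by gcongr
      _ = _ := by ring

theorem slash_slashTerm (k : ℕ) (m : ℤ) (M : SL(2, ℝ)) (z : ℍ) :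
    SlashAction.map (k : ℤ) (M : GL (Fin 2) ℝ) (fun w : ℍ => e (m * (w : ℂ))) z =
      slashTerm k m M z := by
  have h2 := UpperHalfPlane.coe_specialLinearGroup_apply M z
  have h3 : ((M : GL (Fin 2) ℝ) • z) = M • z := rfl
  rw [ModularForm.slash_apply, h3, h2]
  simp [slashTerm, UpperHalfPlane.denom, UpperHalfPlane.σ, div_eq_mul_inv]

theorem poincareTerm_eq (k : ℕ) (m : ℤ) (σ γ : SL(2, ℝ)) (z : ℍ) :
    poincareTerm k m σ γ z = slashTerm k m (σ⁻¹ * γ) z := by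
  rw [poincareTerm, slash_slashTerm]

theorem slash_SL_apply (k : ℕ) (M : SL(2, ℝ)) (f : ℍ → ℂ) (z : ℍ) :
    SlashAction.map (k : ℤ) (M : GL (Fin 2) ℝ) f z =
      f (M • z) * ((M 1 0 * (z : ℂ) + M 1 1) ^ k)⁻¹ := by
  rw [ModularForm.slash_apply, show (M : GL (Fin 2) ℝ) • z = M • z from rfl]
  simp [UpperHalfPlane.denom, UpperHalfPlane.σ]

theorem slash_poincareTerm (k : ℕ) (m : ℤ) (σ γ τ : SL(2, ℝ)) (z : ℍ) :
    SlashAction.map (k : ℤ) (τ : GL (Fin 2) ℝ) (poincareTerm k m σ γ) z =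
      slashTerm k m (σ⁻¹ * γ * τ) z := by
  rw [poincareTerm, ← SlashAction.slash_mul, ← map_mul, slash_slashTerm]

end SlashTerm

/-! ### Absolute convergence of the Poincaré series. -/

section Poincare

variable {Γ : Subgroup SL(2, ℝ)} {𝔞 : OnePoint ℝ} {σ : SL(2, ℝ)} {k : ℕ}

theorem exists_rowSq_inv_bound (hΓ : DiscreteTopology Γ) (hσ : IsCuspScaling Γ 𝔞 σ)
    (τ : SL(2, ℝ)) :
    ∃ R : ℝ, 0 ≤ R ∧ ∀ p : CuspCosets Γ 𝔞, (rowSq (σ⁻¹ * (p.out : Γ) * τ))⁻¹ ≤ R := by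
  have hs := summable_rowSq hΓ hσ τ
  refine ⟨1 + ∑' p : CuspCosets Γ 𝔞, ((rowSq (σ⁻¹ * (p.out : Γ) * τ))⁻¹) ^ 2,
    add_nonneg zero_le_one (tsum_nonneg fun p => by positivity), fun p => ?_⟩
  have h1 := hs.le_tsum p fun q _ => by positivity
  set x := (rowSq (σ⁻¹ * (p.out : Γ) * τ))⁻¹
  nlinarith [sq_nonneg (x - 1)]

theorem exists_summable_bound (hΓ : DiscreteTopology Γ) (hσ : IsCuspScaling Γ 𝔞 σ) (hk : Even k)
    (hk4 : 4 ≤ k) (m : ℤ) (τ : SL(2, ℝ)) {B y : ℝ} (hB : 0 ≤ B) (hy : 0 < y) :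
    ∃ b : CuspCosets Γ 𝔞 → ℝ, Summable b ∧ ∀ p (z : ℂ), ‖z‖ ≤ B → y ≤ z.im →
      ‖slashTerm k m (σ⁻¹ * (p.out : Γ) * τ) z‖ ≤ b p := by
  obtain ⟨R, hR, hRb⟩ := exists_rowSq_inv_bound hΓ hσ τ
  obtain ⟨K, -, hb⟩ := exists_slashTerm_bound hk hk4 m hB hy hR
  exact ⟨_, (summable_rowSq hΓ hσ τ).mul_left K, fun p z h1 h2 => hb _ z (hRb p) h1 h2⟩

theorem summable_slashTerm (hΓ : DiscreteTopology Γ) (hσ : IsCuspScaling Γ 𝔞 σ) (hk : Even k)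
    (hk4 : 4 ≤ k) (m : ℤ) (τ : SL(2, ℝ)) {z : ℂ} (hz : 0 < z.im) :
    Summable fun p : CuspCosets Γ 𝔞 => slashTerm k m (σ⁻¹ * (p.out : Γ) * τ) z := by
  obtain ⟨b, hb, h⟩ := exists_summable_bound hΓ hσ hk hk4 m τ (norm_nonneg z) hz
  exact Summable.of_norm_bounded hb fun p => h p z le_rfl le_rfl

theorem summable_poincareTerm (hΓ : DiscreteTopology Γ) (hσ : IsCuspScaling Γ 𝔞 σ) (hk : Even k)
    (hk4 : 4 ≤ k) (m : ℤ) (z : ℍ) :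
    Summable fun p : CuspCosets Γ 𝔞 => poincareTerm k m σ (p.out : Γ) z := by
  simp only [poincareTerm_eq]
  simpa using summable_slashTerm hΓ hσ hk hk4 m 1 z.im_pos

theorem slash_poincareSeries (m : ℤ) (τ : SL(2, ℝ)) (z : ℍ) :
    SlashAction.map (k : ℤ) (τ : GL (Fin 2) ℝ) (poincareSeries Γ 𝔞 σ k m) z =
      ∑' p : CuspCosets Γ 𝔞, slashTerm k m (σ⁻¹ * (p.out : Γ) * τ) z := by
  simp only [← slash_poincareTerm, slash_SL_apply, poincareSeries]
  rw [← tsum_mul_right]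

end Poincare

end

section

open MeasureTheory Filter Topology

/-! ### Shifting horizontal contours. -/

section ContourShift

theorem integrable_exp_neg_mul_abs {a : ℝ} (ha : 0 < a) :
    Integrable fun t : ℝ => Real.exp (-a * |t|) := by
  rw [← integrableOn_univ, ← Set.Iic_union_Ioi (a := (0 : ℝ))]
  refine IntegrableOn.union ?_ ?_
  · refine (integrableOn_exp_mul_Iic ha 0).congr_fun (fun t ht => ?_) measurableSet_Iic
    simp only
    rw [abs_of_nonpos ht]
    ring_nf
  · refine (integrableOn_exp_mul_Ioi (neg_lt_zero.2 ha) 0).congr_fun (fun t ht => ?_)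
      measurableSet_Ioi
    simp only
    rw [abs_of_pos ht]

variable {F : ℂ → ℂ} {θ K a : ℝ}

theorem integrable_horizontal (ha : 0 < a)
    (hF : DifferentiableOn ℂ F {u | |u.im| ≤ |θ|})
    (hb : ∀ u : ℂ, |u.im| ≤ |θ| → ‖F u‖ ≤ K * Real.exp (-a * |u.re|)) {y : ℝ} (hy : |y| ≤ |θ|) :
    Integrable fun t : ℝ => F (t + y * Complex.I) := by
  refine Integrable.mono' ((integrable_exp_neg_mul_abs ha).const_mul K) ?_ ?_
  · refine Continuous.aestronglyMeasurable ?_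
    refine hF.continuousOn.comp_continuous (by fun_prop) fun t => ?_
    simpa using hy
  · refine Eventually.of_forall fun t => ?_
    have := hb (t + y * Complex.I) (by simpa using hy)
    simpa using this

/-- The integral of a holomorphic function with exponential decay is the same along all
horizontal lines of a strip. -/
theorem integral_horizontal_eq (ha : 0 < a)
    (hF : DifferentiableOn ℂ F {u | |u.im| ≤ |θ|})
    (hb : ∀ u : ℂ, |u.im| ≤ |θ| → ‖F u‖ ≤ K * Real.exp (-a * |u.re|)) :
    ∫ t : ℝ, F (t + θ * Complex.I) = ∫ t : ℝ, F t := by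
  have hmem : ∀ y ∈ Set.uIcc 0 θ, |y| ≤ |θ| := by
    intro y hy
    have := Set.abs_sub_left_of_mem_uIcc hy
    simpa using this
  have hi0 := integrable_horizontal ha hF hb (y := 0) (by simp)
  have hiθ := integrable_horizontal ha hF hb (y := θ) le_rfl
  simp only [Complex.ofReal_zero, zero_mul, add_zero] at hi0
  have hrect : ∀ T : ℝ, (∫ x : ℝ in -T..T, F x) - (∫ x : ℝ in -T..T, F (x + θ * Complex.I)) =
      Complex.I • (∫ y : ℝ in (0 : ℝ)..θ, F (-T + y * Complex.I)) -
        Complex.I • (∫ y : ℝ in (0 : ℝ)..θ, F (T + y * Complex.I)) := by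
    intro T
    have h := Complex.integral_boundary_rect_eq_zero_of_differentiableOn F (-T : ℝ)
      (T + θ * Complex.I) (by
        refine hF.mono fun u hu => ?_
        have h2 := hu.2
        simp only [Complex.ofReal_im, Complex.add_im, Complex.mul_im, Complex.ofReal_re,
          Complex.I_im, mul_one, Complex.I_re, mul_zero, add_zero, zero_add] at h2
        exact hmem _ h2)
    simp only [Complex.ofReal_neg, Complex.neg_re, Complex.ofReal_re, Complex.add_re,
      Complex.mul_re, Complex.I_re, mul_zero, Complex.ofReal_im, Complex.I_im, mul_one, sub_self,
      add_zero, Complex.neg_im, neg_zero, Complex.ofReal_zero, zero_mul, Complex.add_im,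
      Complex.mul_im, zero_add] at h
    linear_combination h
  have hK : 0 ≤ K := by
    have := (norm_nonneg _).trans (hb 0 (by simp))
    simpa using this
  -- The vertical sides of the rectangle, right for ε = 1 and left for ε = -1, are O(e^(-aT)).
  have hvert : ∀ ε : ℝ, |ε| = 1 → Tendsto (fun T : ℝ => Complex.I •
      (∫ y : ℝ in (0 : ℝ)..θ, F ((ε * T : ℝ) + y * Complex.I))) atTop (𝓝 0) := by
    intro ε hε
    have hlim : Tendsto (fun T : ℝ => K * Real.exp (-a * T) * |θ - 0|) atTop (𝓝 0) := by
      have h1 : Tendsto (fun T : ℝ => Real.exp (-a * T)) atTop (𝓝 0) := by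
        refine Real.tendsto_exp_atBot.comp ?_
        exact tendsto_id.const_mul_atTop_of_neg (neg_lt_zero.2 ha)
      simpa using (h1.const_mul K).mul_const |θ - 0|
    refine squeeze_zero_norm' ?_ hlim
    filter_upwards [eventually_ge_atTop 0] with T hT
    rw [norm_smul, Complex.norm_I, one_mul]
    refine intervalIntegral.norm_integral_le_of_norm_le_const fun y hy => ?_
    have := hb ((ε * T : ℝ) + y * Complex.I) (by
      simpa using hmem y (Set.uIoc_subset_uIcc hy))
    simpa [abs_mul, hε, abs_of_nonneg hT] using this
  have hlim0 : Tendsto (fun T : ℝ => (∫ x : ℝ in -T..T, F x) -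
      (∫ x : ℝ in -T..T, F (x + θ * Complex.I))) atTop (𝓝 0) := by
    simp only [hrect]
    have h1 := hvert (-1) (by simp)
    have h2 := hvert 1 (by simp)
    simpa using h1.sub h2
  have h1 := intervalIntegral_tendsto_integral hi0 tendsto_neg_atTop_atBot tendsto_id
  have h2 := intervalIntegral_tendsto_integral hiθ tendsto_neg_atTop_atBot tendsto_id
  exact (sub_eq_zero.1 (tendsto_nhds_unique (h1.sub h2) hlim0)).symm

end ContourShift

/-! ### The Beta integral on a horizontal line. -/

section Beta

/-- The integrand `e ^ (us) / (1 + e ^ u) ^ N` of the Beta function on the line. -/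
def betaKernel (s : ℂ) (N : ℕ) (u : ℂ) : ℂ := Complex.exp (u * s) / (1 + Complex.exp u) ^ N

/-- With x = e^(Re u) and φ = Im u, the difference of the squares is (1 - cos θ)(1 - x)²/2 + 2x(cos
φ - cos θ), and both terms are nonnegative. -/
theorem norm_one_add_exp_ge {u : ℂ} {θ : ℝ} (hθ : θ < Real.pi) (hu : |u.im| ≤ θ) :
    Real.cos (θ / 2) * (1 + Real.exp u.re) ≤ ‖1 + Complex.exp u‖ := by
  have hθ0 : 0 ≤ θ := (abs_nonneg _).trans hu
  refine (le_abs_self _).trans (abs_le_of_sq_le_sq ?_ (norm_nonneg _))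
  have hcos : Real.cos θ ≤ Real.cos u.im := by
    rw [← Real.cos_abs u.im]
    exact Real.cos_le_cos_of_nonneg_of_le_pi (abs_nonneg _) hθ.le hu
  have h1 : Real.cos (θ / 2) ^ 2 = 1 / 2 + Real.cos θ / 2 := by
    rw [Real.cos_sq]; ring_nf
  rw [← Complex.normSq_eq_norm_sq, Complex.normSq_apply, mul_pow, h1]
  simp only [Complex.add_re, Complex.one_re, Complex.exp_re, Complex.add_im, Complex.one_im,
    Complex.exp_im, zero_add]
  have h2 := Real.exp_pos u.re
  have h3 := Real.sin_sq_add_cos_sq u.im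
  have h4 := Real.cos_le_one θ
  set x := Real.exp u.re
  have e : (1 + x * Real.cos u.im) * (1 + x * Real.cos u.im) +
      x * Real.sin u.im * (x * Real.sin u.im) = 1 + 2 * x * Real.cos u.im + x ^ 2 := by
    linear_combination x ^ 2 * h3
  rw [e]
  nlinarith [mul_nonneg (sub_nonneg.2 h4) (sq_nonneg (1 - x)), mul_nonneg h2.le
    (sub_nonneg.2 hcos)]

theorem cos_half_pos {θ : ℝ} (hθ0 : 0 ≤ θ) (hθ : θ < Real.pi) : 0 < Real.cos (θ / 2) :=
  Real.cos_pos_of_mem_Ioo ⟨by linarith [Real.pi_pos], by linarith⟩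

theorem one_add_exp_ne_zero {u : ℂ} (hu : |u.im| < Real.pi) : 1 + Complex.exp u ≠ 0 := by
  have h1 := norm_one_add_exp_ge hu le_rfl
  have h2 := cos_half_pos (abs_nonneg _) hu
  have h3 := Real.exp_pos u.re
  exact norm_pos_iff.1 (lt_of_lt_of_le (by positivity) h1)

theorem norm_exp_div_one_add_exp_le {u : ℂ} {θ : ℝ} (hθ : θ < Real.pi) (hu : |u.im| ≤ θ) :
    ‖Complex.exp u / (1 + Complex.exp u)‖ ≤ (Real.cos (θ / 2))⁻¹ := by
  have h1 := norm_one_add_exp_ge hθ hu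
  have h2 := cos_half_pos ((abs_nonneg _).trans hu) hθ
  have h3 := Real.exp_pos u.re
  rw [norm_div, Complex.norm_exp, inv_eq_one_div,
    div_le_div_iff₀ (lt_of_lt_of_le (by positivity) h1) h2]
  nlinarith

/-- The denominator is compared with e^(tN) for t ≥ 0 and with 1 for t ≤ 0. -/
theorem exp_mul_div_le {t p : ℝ} {N : ℕ} :
    Real.exp (t * p) / (1 + Real.exp t) ^ N ≤ Real.exp (-(min p (N - p)) * |t|) := by
  have h1 := Real.exp_pos t
  rw [div_le_iff₀ (by positivity)]
  rcases le_total 0 t with ht | ht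
  · have h2 : Real.exp (t * N) ≤ (1 + Real.exp t) ^ N := by
      rw [mul_comm, Real.exp_nat_mul]
      gcongr
      linarith
    refine le_trans ?_ (mul_le_mul_of_nonneg_left h2 (Real.exp_pos _).le)
    rw [← Real.exp_add, abs_of_nonneg ht]
    apply Real.exp_le_exp.2
    have := mul_le_mul_of_nonneg_right (min_le_right p (N - p)) ht
    linarith
  · have h2 : 1 ≤ (1 + Real.exp t) ^ N := one_le_pow₀ (by linarith)
    refine le_trans ?_ (mul_le_mul_of_nonneg_left h2 (Real.exp_pos _).le)
    rw [mul_one, abs_of_nonpos ht]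
    apply Real.exp_le_exp.2
    have := mul_le_mul_of_nonneg_right (min_le_left p (N - p)) (neg_nonneg.2 ht)
    linarith

variable {s : ℂ} {N : ℕ} {θ : ℝ}

theorem differentiableOn_betaKernel (hθ : |θ| < Real.pi) :
    DifferentiableOn ℂ (betaKernel s N) {u | |u.im| ≤ |θ|} := by
  intro u hu
  refine DifferentiableAt.differentiableWithinAt ?_
  unfold betaKernel
  refine DifferentiableAt.div (by fun_prop) (by fun_prop) ?_
  exact pow_ne_zero _ (one_add_exp_ne_zero (lt_of_le_of_lt hu hθ))

theorem norm_betaKernel_le (hθ : |θ| < Real.pi) (u : ℂ) (hu : |u.im| ≤ |θ|) :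
    ‖betaKernel s N u‖ ≤ (Real.exp (|θ| * |s.im|) * (Real.cos (|θ| / 2) ^ N)⁻¹) *
      Real.exp (-(min s.re (N - s.re)) * |u.re|) := by
  have h1 := norm_one_add_exp_ge hθ hu
  have h2 := cos_half_pos (abs_nonneg _) hθ
  have h3 := Real.exp_pos u.re
  refine le_trans ?_ (mul_le_mul_of_nonneg_left (exp_mul_div_le (t := u.re) (p := s.re) (N := N))
    (by positivity))
  rw [betaKernel, norm_div, Complex.norm_exp, norm_pow, Complex.mul_re]
  have h4 : ‖1 + Complex.exp u‖ ^ N ≥ (Real.cos (|θ| / 2) * (1 + Real.exp u.re)) ^ N := by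
    gcongr
  have h5 : Real.exp (u.re * s.re - u.im * s.im) ≤
      Real.exp (|θ| * |s.im|) * Real.exp (u.re * s.re) := by
    rw [← Real.exp_add]
    apply Real.exp_le_exp.2
    have := neg_abs_le (u.im * s.im)
    rw [abs_mul] at this
    have := mul_le_mul_of_nonneg_right hu (abs_nonneg s.im)
    linarith
  calc Real.exp (u.re * s.re - u.im * s.im) / ‖1 + Complex.exp u‖ ^ N
      ≤ Real.exp (|θ| * |s.im|) * Real.exp (u.re * s.re) /
        (Real.cos (|θ| / 2) * (1 + Real.exp u.re)) ^ N := by gcongr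
    _ = _ := by rw [mul_pow]; field_simp

theorem integrable_betaKernel (hs : 0 < s.re) (hsN : s.re < N) (hθ : |θ| < Real.pi) :
    Integrable fun t : ℝ => betaKernel s N (t + θ * Complex.I) :=
  integrable_horizontal (lt_min hs (sub_pos.2 hsN)) (differentiableOn_betaKernel hθ)
    (norm_betaKernel_le hθ) le_rfl

/-- Substitution x = `Real.sigmoid t`, with dx = x(1 - x) dt and 1 - x = 1/(1 + e^t). Both are
written as real exponentials, so that the complex powers become exponentials. -/
theorem integral_betaKernel_real (s : ℂ) (N : ℕ) :
    ∫ t : ℝ, betaKernel s N t = Complex.betaIntegral s (N - s) := by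
  rw [Complex.betaIntegral, intervalIntegral.integral_of_le zero_le_one,
    integral_Ioc_eq_integral_Ioo, ← Real.range_sigmoid, ← Set.image_univ,
    integral_image_eq_integral_abs_deriv_smul MeasurableSet.univ
      (fun x _ => (Real.hasDerivAt_sigmoid x).hasDerivWithinAt)
      Real.sigmoid_injective.injOn, Measure.restrict_univ]
  congr 1
  ext t
  have hx := Real.sigmoid_pos t
  have hx1 := Real.sigmoid_lt_one t
  have ht := Real.exp_pos t
  have hL : Complex.exp (Real.log (1 + Real.exp t)) = 1 + Complex.exp t := by
    rw [← Complex.ofReal_exp, Real.exp_log (by positivity)]; simp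
  have e1 : Real.sigmoid t = Real.exp (t - Real.log (1 + Real.exp t)) := by
    rw [Real.exp_sub, Real.exp_log (by positivity), Real.sigmoid_def, Real.exp_neg]
    field_simp
    ring
  have e2 : 1 - Real.sigmoid t = Real.exp (-Real.log (1 + Real.exp t)) := by
    rw [e1, Real.exp_sub, Real.exp_neg, Real.exp_log (by positivity)]
    field_simp
    ring
  have p : ∀ (x : ℝ) (z : ℂ), ((Real.exp x : ℝ) : ℂ) ^ z = Complex.exp (x * z) := by
    intro x z
    rw [Complex.cpow_def_of_ne_zero (by exact_mod_cast (Real.exp_pos x).ne'), ← Complex.ofReal_log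
      (Real.exp_pos x).le, Real.log_exp]
  have e3 : (1 - (Real.sigmoid t : ℂ)) = ((Real.exp (-Real.log (1 + Real.exp t)) : ℝ) : ℂ) := by
    rw [← e2]; simp
  rw [abs_of_pos (mul_pos hx (sub_pos.2 hx1)), e2, e3, e1, p, p, Complex.real_smul, betaKernel,
    ← hL, ← Complex.exp_nat_mul, ← Complex.exp_sub]
  push_cast
  rw [← Complex.exp_add, ← Complex.exp_add, ← Complex.exp_add]
  congr 1
  ring

theorem integral_betaKernel (hs : 0 < s.re) (hsN : s.re < N) (hθ : |θ| < Real.pi) :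
    ∫ t : ℝ, betaKernel s N (t + θ * Complex.I) = Complex.betaIntegral s (N - s) := by
  rw [← integral_betaKernel_real]
  exact integral_horizontal_eq (lt_min hs (sub_pos.2 hsN)) (differentiableOn_betaKernel hθ)
    (norm_betaKernel_le hθ)

theorem ne_neg_nat_of_re_pos {z : ℂ} (hz : 0 < z.re) (j : ℕ) : z ≠ -j := by
  rintro rfl
  simp at hz
  linarith [(Nat.cast_nonneg j : (0 : ℝ) ≤ j)]

/-- Quotients of Gamma values at points differing by j are Pochhammer symbols; this produces the
coefficients of ₁F₁. -/
theorem betaIntegral_add_nat {a b : ℂ} (ha : 0 < a.re) (hb : 0 < b.re) (j : ℕ) :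
    Complex.betaIntegral (a + j) b = Complex.betaIntegral a b *
      ((ascPochhammer ℂ j).eval a / (ascPochhammer ℂ j).eval (a + b)) := by
  have haj : 0 < (a + j).re := by simp; positivity
  have hab : 0 < (a + b).re := by simp; positivity
  have habj : 0 < (a + b + j).re := by simp; positivity
  have h1 := Complex.Gamma_mul_Gamma_eq_betaIntegral ha hb
  have h2 := Complex.Gamma_mul_Gamma_eq_betaIntegral haj hb
  rw [← Complex.Gamma_add_nat_div_Gamma_eq a (ne_neg_nat_of_re_pos ha),
    ← Complex.Gamma_add_nat_div_Gamma_eq (a + b) (ne_neg_nat_of_re_pos hab)]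
  have g1 := Complex.Gamma_ne_zero_of_re_pos ha
  have g2 := Complex.Gamma_ne_zero_of_re_pos hab
  have g3 := Complex.Gamma_ne_zero_of_re_pos habj
  rw [show a + j + b = a + b + j by ring] at h2
  field_simp
  linear_combination (-Complex.Gamma a) * h2 + Complex.Gamma (a + j) * h1

end Beta

/-! ### Evaluation of the parabolic/hyperbolic integral. -/

section ParHyp

/-- The angle `φ ∈ {0, π}` with `e ^ (iφ) = sgn r`. -/
def signArg (r : ℝ) : ℝ := if 0 < r then 0 else Real.pi

/-- Putting v = u - iφ treats both signs of r at once: the strip 0 < Im u < π is carried into |Im v|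
< π, where 1 + e^v has no zero. -/
theorem exp_sub_signArg {r : ℝ} (hr : r ≠ 0) (u : ℂ) :
    Complex.exp (u - signArg r * Complex.I) = Real.sign r * Complex.exp u := by
  rcases lt_or_gt_of_ne hr with h | h
  · rw [signArg, if_neg h.not_gt, Complex.exp_sub, Complex.exp_pi_mul_I, Real.sign_of_neg h]
    simp [div_neg]
  · rw [signArg, if_pos h, Real.sign_of_pos h]
    simp

theorem abs_sub_signArg_lt {y : ℝ} (hy : 0 < y) (hyπ : y < Real.pi) (r : ℝ) :
    |y - signArg r| < Real.pi := by
  rw [signArg, abs_lt]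
  split_ifs <;> constructor <;> linarith

variable {k : ℕ} {ℓ : ℝ} {m n : ℤ} {r y : ℝ}

/-- Rests on (w - 1)/(2r(w + 1)) = -1/(2r) + (1/r) w/(1 + w) with w = e^v: a constant phase plus a
multiple of a function bounded on horizontal lines. -/
theorem parHypIntegrand_eq (hr : r ≠ 0) {u : ℂ} (hu : |u.im - signArg r| < Real.pi) :
    parHypIntegrand k ℓ m n r u =
      (e (-m / (2 * r)) * Complex.exp (signArg r * Complex.I *
        ((k : ℂ) / 2 - 2 * Real.pi * Complex.I * n / ℓ)) / ℓ) *
      (Complex.exp (2 * Real.pi * Complex.I * m / r *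
        (Complex.exp (u - signArg r * Complex.I) / (1 + Complex.exp (u - signArg r * Complex.I)))) *
      betaKernel ((k : ℂ) / 2 - 2 * Real.pi * Complex.I * n / ℓ) k
        (u - signArg r * Complex.I)) := by
  have hr' : (r : ℂ) ≠ 0 := by exact_mod_cast hr
  set v := u - signArg r * Complex.I with hv
  set s := (k : ℂ) / 2 - 2 * Real.pi * Complex.I * n / ℓ with hs
  have hv0 : 1 + Complex.exp v ≠ 0 := by
    apply one_add_exp_ne_zero
    simpa [hv] using hu
  rw [parHypIntegrand, ← exp_sub_signArg hr u, ← hv, ← hs, betaKernel, e, e,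
    show u = v + signArg r * Complex.I by rw [hv]; ring, add_mul, Complex.exp_add, add_comm _ 1]
  rw [show 2 * Real.pi * Complex.I * (m * ((Complex.exp v - 1) / (2 * r * (1 + Complex.exp v)))) =
    2 * Real.pi * Complex.I * (-m / (2 * r)) + 2 * Real.pi * Complex.I * m / r *
      (Complex.exp v / (1 + Complex.exp v)) by field_simp; ring, Complex.exp_add]
  ring

theorem re_exponent (k : ℕ) (ℓ : ℝ) (n : ℤ) :
    ((k : ℂ) / 2 - 2 * Real.pi * Complex.I * n / ℓ).re = k / 2 := by
  have : (2 * Real.pi * Complex.I * n / ℓ : ℂ) = ((2 * Real.pi * n / ℓ : ℝ) : ℂ) * Complex.I := by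
    push_cast; ring
  rw [this]
  simp

theorem line_sub_signArg (t y r : ℝ) :
    (t + y * Complex.I - signArg r * Complex.I : ℂ) =
      t + ((y - signArg r : ℝ) : ℂ) * Complex.I := by
  push_cast; ring

theorem parHypIntegrand_line (hr : r ≠ 0) (hy : 0 < y) (hyπ : y < Real.pi) (t : ℝ) :
    parHypIntegrand k ℓ m n r (t + y * Complex.I) =
      (e (-m / (2 * r)) * Complex.exp (signArg r * Complex.I *
        ((k : ℂ) / 2 - 2 * Real.pi * Complex.I * n / ℓ)) / ℓ) *
      (Complex.exp (2 * Real.pi * Complex.I * m / r *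
        (Complex.exp (t + ((y - signArg r : ℝ) : ℂ) * Complex.I) /
          (1 + Complex.exp (t + ((y - signArg r : ℝ) : ℂ) * Complex.I)))) *
      betaKernel ((k : ℂ) / 2 - 2 * Real.pi * Complex.I * n / ℓ) k
        (t + ((y - signArg r : ℝ) : ℂ) * Complex.I)) := by
  rw [parHypIntegrand_eq hr (by simpa using abs_sub_signArg_lt hy hyπ r), line_sub_signArg]

/-- The power series expansion of the integrand, integrated term by term. -/
theorem hasSum_integral_exp_mul_betaKernel (x : ℂ) {s : ℂ} {N : ℕ} {θ : ℝ} (hs : 0 < s.re)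
    (hsN : s.re < N) (hθ : |θ| < Real.pi) :
    (Integrable fun t : ℝ => Complex.exp (x * (Complex.exp (t + θ * Complex.I) /
        (1 + Complex.exp (t + θ * Complex.I)))) * betaKernel s N (t + θ * Complex.I)) ∧
    HasSum (fun j : ℕ => x ^ j / (j.factorial : ℂ) * Complex.betaIntegral (s + j) (N - s))
      (∫ t : ℝ, Complex.exp (x * (Complex.exp (t + θ * Complex.I) /
        (1 + Complex.exp (t + θ * Complex.I)))) * betaKernel s N (t + θ * Complex.I)) := by
  set κ := (Real.cos (|θ| / 2))⁻¹ with hκ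
  have hκ0 : 0 < κ := inv_pos.2 (cos_half_pos (abs_nonneg _) hθ)
  have him : ∀ t : ℝ, |(t + θ * Complex.I : ℂ).im| ≤ |θ| := fun t => by simp
  have hw : ∀ t : ℝ, ‖Complex.exp (t + θ * Complex.I) / (1 + Complex.exp (t + θ * Complex.I))‖ ≤ κ :=
    fun t => norm_exp_div_one_add_exp_le hθ (him t)
  have hne : ∀ t : ℝ, 1 + Complex.exp (t + θ * Complex.I) ≠ 0 :=
    fun t => one_add_exp_ne_zero ((him t).trans_lt hθ)
  have hint := integrable_betaKernel hs hsN hθ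
  refine ⟨?_, ?_⟩
  · refine hint.bdd_mul (c := Real.exp (‖x‖ * κ)) ?_ ?_
    · refine Continuous.aestronglyMeasurable ?_
      refine Complex.continuous_exp.comp (continuous_const.mul ?_)
      exact Continuous.div (by fun_prop) (by fun_prop) hne
    · refine Eventually.of_forall fun t => ?_
      refine (Complex.norm_exp_le_exp_norm _).trans ?_
      rw [norm_mul]
      have := hw t
      gcongr
  -- A factor (e^v/(1 + e^v))^j raises s and N together, so the second Beta argument N - s stays
  -- fixed.
  have hker : ∀ (j : ℕ) (t : ℝ), (Complex.exp (t + θ * Complex.I) /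
      (1 + Complex.exp (t + θ * Complex.I))) ^ j * betaKernel s N (t + θ * Complex.I) =
      betaKernel (s + j) (N + j) (t + θ * Complex.I) := by
    intro j t
    have := hne t
    generalize (t + θ * Complex.I : ℂ) = u at this ⊢
    rw [betaKernel, betaKernel, mul_add, Complex.exp_add, mul_comm u (j : ℂ), Complex.exp_nat_mul,
      pow_add, div_pow]
    field_simp
  have hintj : ∀ j : ℕ, Integrable fun t : ℝ =>
      betaKernel (s + j) (N + j) (t + θ * Complex.I) := by
    intro j
    refine integrable_betaKernel ?_ ?_ hθ
    · simp; positivity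
    · simpa using hsN
  have hval : ∀ j : ℕ, ∫ t : ℝ, betaKernel (s + j) (N + j) (t + θ * Complex.I) =
      Complex.betaIntegral (s + j) (N - s) := by
    intro j
    rw [integral_betaKernel (by simp; positivity) (by simpa using hsN) hθ]
    congr 1
    push_cast; ring
  have key := hasSum_integral_of_summable_integral_norm
    (F := fun (j : ℕ) (t : ℝ) => x ^ j / (j.factorial : ℂ) *
      betaKernel (s + j) (N + j) (t + θ * Complex.I)) (μ := volume)
    (fun j => (hintj j).const_mul _) ?_
  · simp only [integral_const_mul, hval] at key
    convert! key using 1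
    congr 1
    ext t
    simp only [← hker, ← mul_assoc]
    rw [tsum_mul_right]
    congr 1
    rw [Complex.exp_eq_exp_ℂ, NormedSpace.exp_eq_tsum_div]
    simp only
    refine tsum_congr fun j => ?_
    rw [mul_pow]; ring
  -- Since |e^v/(1 + e^v)| ≤ κ on the line, the exponential series of ‖x‖κ dominates the L¹ norms.
  · have hsum : Summable fun j : ℕ => (‖x‖ * κ) ^ j / (j.factorial : ℝ) *
        ∫ t : ℝ, ‖betaKernel s N (t + θ * Complex.I)‖ :=
      (Real.summable_pow_div_factorial _).mul_right _
    refine Summable.of_nonneg_of_le (fun j => integral_nonneg fun t => norm_nonneg _)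
      (fun j => ?_) hsum
    rw [← integral_const_mul]
    refine integral_mono ((hintj j).const_mul _).norm (hint.norm.const_mul _) fun t => ?_
    simp only
    rw [← hker, norm_mul, norm_mul, norm_div, norm_pow, norm_pow, mul_pow, Complex.norm_natCast]
    have := hw t
    calc ‖x‖ ^ j / (j.factorial : ℝ) * (‖Complex.exp (t + θ * Complex.I) /
          (1 + Complex.exp (t + θ * Complex.I))‖ ^ j * ‖betaKernel s N (t + θ * Complex.I)‖)
        ≤ ‖x‖ ^ j / (j.factorial : ℝ) * (κ ^ j * ‖betaKernel s N (t + θ * Complex.I)‖) := by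
          gcongr
      _ = _ := by ring

theorem integrable_parHypIntegrand (hk : 0 < k) (hr : r ≠ 0) (hy : 0 < y) (hyπ : y < Real.pi) :
    Integrable fun t : ℝ => parHypIntegrand k ℓ m n r (t + y * Complex.I) := by
  have hk' : (0 : ℝ) < k := by exact_mod_cast hk
  have hθ := abs_sub_signArg_lt hy hyπ r
  have h := (hasSum_integral_exp_mul_betaKernel (2 * Real.pi * Complex.I * m / r)
    (s := (k : ℂ) / 2 - 2 * Real.pi * Complex.I * n / ℓ) (N := k)
    (by rw [re_exponent]; linarith) (by rw [re_exponent]; linarith) hθ).1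
  simp only [parHypIntegrand_line hr hy hyπ]
  exact h.const_mul _

/-- The explicit evaluation of the parabolic/hyperbolic integral. -/
theorem parHypIntegral_eq (hk : 0 < k) (hr : r ≠ 0) (hy : 0 < y) (hyπ : y < Real.pi) :
    parHypIntegral k ℓ m n r y =
      (e (-m / (2 * r)) * Complex.exp (signArg r * Complex.I *
        ((k : ℂ) / 2 - 2 * Real.pi * Complex.I * n / ℓ)) / ℓ) *
      (Complex.betaIntegral ((k : ℂ) / 2 - 2 * Real.pi * Complex.I * n / ℓ)
        ((k : ℂ) / 2 + 2 * Real.pi * Complex.I * n / ℓ) *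
      hyp1F1 ((k : ℂ) / 2 - 2 * Real.pi * Complex.I * n / ℓ) k
        (2 * Real.pi * Complex.I * m / r)) := by
  have hk' : (0 : ℝ) < k := by exact_mod_cast hk
  have hθ := abs_sub_signArg_lt hy hyπ r
  have hre := re_exponent k ℓ n
  have h := (hasSum_integral_exp_mul_betaKernel (2 * Real.pi * Complex.I * m / r)
    (s := (k : ℂ) / 2 - 2 * Real.pi * Complex.I * n / ℓ) (N := k)
    (by rw [hre]; linarith) (by rw [hre]; linarith) hθ).2
  rw [parHypIntegral]
  simp only [parHypIntegrand_line hr hy hyπ]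
  rw [integral_const_mul, ← h.tsum_eq, hyp1F1, ← tsum_mul_left (a := Complex.betaIntegral _ _)]
  congr 1
  refine tsum_congr fun j => ?_
  set s := (k : ℂ) / 2 - 2 * Real.pi * Complex.I * n / ℓ with hs
  have e1 : (k : ℂ) / 2 + 2 * Real.pi * Complex.I * n / ℓ = k - s := by rw [hs]; ring
  rw [e1, betaIntegral_add_nat (by rw [hre]; linarith)
    (by rw [Complex.sub_re, hre, Complex.natCast_re]; linarith) j, add_sub_cancel]
  ring

end ParHyp

end

section

open MeasureTheory Filter Topology

/-! ### Passing to the strip and the action of the two stabilizers. -/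

section Invariance

variable {k : ℕ} {m : ℤ}

theorem e_add (z w : ℂ) : e (z + w) = e z * e w := by
  rw [e, e, e, mul_add, Complex.exp_add]

theorem e_intCast (j : ℤ) : e j = 1 := by
  rw [e, mul_comm]
  exact Complex.exp_int_mul_two_pi_mul_I j

theorem slashTerm_neg (hk : Even k) (M : SL(2, ℝ)) (z : ℂ) :
    slashTerm k m (-M) z = slashTerm k m M z := by
  simp only [slashTerm, neg_entry, Complex.ofReal_neg, neg_mul, ← neg_add, neg_div_neg_eq,
    hk.neg_pow]

theorem slashTerm_translation_mul (j : ℤ) (M : SL(2, ℝ)) {z : ℂ} (hz : 0 < z.im) :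
    slashTerm k m (translation j * M) z = slashTerm k m M z := by
  have hd := denom_ne_zero M hz
  simp only [slashTerm, mul_entry, translation_00, translation_01, translation_10,
    translation_11, one_mul, zero_mul, zero_add]
  have e1 : (m : ℂ) * (((M 0 0 + j * M 1 0 : ℝ) * z + (M 0 1 + j * M 1 1 : ℝ)) /
      (M 1 0 * z + M 1 1)) =
      m * ((M 0 0 * z + M 0 1) / (M 1 0 * z + M 1 1)) + (m * j : ℤ) := by
    push_cast
    field_simp
    ring
  rw [e1, e_add, e_intCast, mul_one]

/-- The function `e ^ (ku/2) (e(m ·) |_k M)(e ^ u)` on the strip `0 < Im u < π`. -/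
def stripTerm (k : ℕ) (m : ℤ) (M : SL(2, ℝ)) (u : ℂ) : ℂ :=
  slashTerm k m M (Complex.exp u) * Complex.exp (u * (k / 2))

theorem stripTerm_neg (hk : Even k) (M : SL(2, ℝ)) (u : ℂ) :
    stripTerm k m (-M) u = stripTerm k m M u := by
  rw [stripTerm, slashTerm_neg hk, stripTerm]

/-- The weight factor e^(ku/2) absorbs the automorphy factor of the dilation, so that only a
translation of u remains. -/
theorem stripTerm_mul_dilation (M : SL(2, ℝ)) (x : ℝ) (u : ℂ) :
    stripTerm k m (M * dilation x) u = stripTerm k m M (u + x) := by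
  have h0 : Complex.exp (x / 2) ≠ 0 := Complex.exp_ne_zero _
  have lin : ∀ p q : ℂ, p * Complex.exp (x / 2) * Complex.exp u + q * Complex.exp (-(x / 2)) =
      Complex.exp (-(x / 2)) * (p * Complex.exp (u + x) + q) := by
    intro p q
    have hx : Complex.exp x = Complex.exp (x / 2) * Complex.exp (x / 2) := by
      rw [← Complex.exp_add, add_halves]
    rw [Complex.exp_add, hx, Complex.exp_neg]
    field_simp
  simp only [stripTerm, slashTerm, mul_entry, dilation_00, dilation_01, dilation_10, dilation_11,
    mul_zero, add_zero, zero_add]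
  push_cast
  rw [lin, lin, mul_div_mul_left _ _ (Complex.exp_ne_zero _), mul_pow, ← Complex.exp_nat_mul,
    add_mul, Complex.exp_add (u * _), show (k : ℂ) * -(x / 2) = -(x * (k / 2)) by ring,
    Complex.exp_neg]
  have := Complex.exp_ne_zero (x * (k / 2) : ℂ)
  field_simp

theorem exp_im_pos {u : ℂ} (h0 : 0 < u.im) (hπ : u.im < Real.pi) : 0 < (Complex.exp u).im := by
  rw [Complex.exp_im]
  exact mul_pos (Real.exp_pos _) (Real.sin_pos_of_pos_of_lt_pi h0 hπ)

variable {Γ : Subgroup SL(2, ℝ)} {𝔞 η₁ η₂ : OnePoint ℝ} {σ ση : SL(2, ℝ)} {ℓ : ℝ}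

/-- The term depends only on the coset, so the arbitrary representatives chosen by `Quotient.out`
may be replaced. Signs disappear because k is even. -/
theorem slashTerm_coset (hk : Even k) (hσ : IsCuspScaling Γ 𝔞 σ) {γ γ' : Γ}
    (h : γ' * γ⁻¹ ∈ pointStab Γ 𝔞) (τ : SL(2, ℝ)) {z : ℂ} (hz : 0 < z.im) :
    slashTerm k m (σ⁻¹ * γ' * τ) z = slashTerm k m (σ⁻¹ * γ * τ) z := by
  obtain ⟨j, hj⟩ := exists_eq_translation hσ h
  have e1 : σ⁻¹ * (γ' : SL(2, ℝ)) * τ =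
      (σ⁻¹ * ((γ' * γ⁻¹ : Γ) : SL(2, ℝ)) * σ) * (σ⁻¹ * (γ : SL(2, ℝ)) * τ) := by
    simp only [Subgroup.coe_mul, Subgroup.coe_inv]; group
  rw [e1]
  rcases hj with hj | hj
  · rw [hj, slashTerm_translation_mul _ _ hz]
  · rw [hj, neg_mul, slashTerm_neg hk, slashTerm_translation_mul _ _ hz]

theorem stripTerm_cosetOf (hk : Even k) (hσ : IsCuspScaling Γ 𝔞 σ)
    (hη : IsHyperbolicScaling Γ η₁ η₂ ση ℓ) (x : DoubleCosets Γ 𝔞 η₁ η₂ × ℤ) {u : ℂ}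
    (h0 : 0 < u.im) (hπ : u.im < Real.pi) :
    stripTerm k m (σ⁻¹ * ((cosetOf hη x).out : Γ) * ση) u =
      stripTerm k m (repMatrix σ ση x.1) (u + (x.2 * ℓ : ℝ)) := by
  have h1 : (cosetOf hη x).out * ((Quotient.out x.1 : Γ) * generator hη ^ x.2)⁻¹ ∈
      pointStab Γ 𝔞 :=
    QuotientGroup.rightRel_apply.1 (Quotient.exact (Quotient.out_eq (cosetOf hη x)).symm)
  have e1 : σ⁻¹ * (((Quotient.out x.1 : Γ) * generator hη ^ x.2 : Γ) : SL(2, ℝ)) * ση =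
      repMatrix σ ση x.1 * (ση⁻¹ * ((generator hη ^ x.2 : Γ) : SL(2, ℝ)) * ση) := by
    rw [repMatrix]; simp only [Subgroup.coe_mul]; group
  rw [stripTerm, slashTerm_coset hk hσ h1 ση (exp_im_pos h0 hπ), e1, ← stripTerm,
    ← stripTerm_mul_dilation]
  rcases generator_zpow_conj hη x.2 with h | h
  · rw [h]
  · rw [h, mul_neg, stripTerm_neg hk]

theorem continuousOn_stripTerm (M : SL(2, ℝ)) :
    ContinuousOn (stripTerm k m M) {u | 0 < u.im ∧ u.im < Real.pi} := by
  have hd : ∀ u ∈ {u : ℂ | 0 < u.im ∧ u.im < Real.pi},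
      (M 1 0 * Complex.exp u + M 1 1 : ℂ) ≠ 0 :=
    fun u hu => denom_ne_zero M (exp_im_pos hu.1 hu.2)
  unfold stripTerm slashTerm e
  refine ContinuousOn.mul (ContinuousOn.div (Complex.continuous_exp.comp_continuousOn ?_)
    (by fun_prop) fun u hu => pow_ne_zero _ (hd u hu)) (by fun_prop)
  exact continuousOn_const.mul (continuousOn_const.mul
    (ContinuousOn.div (by fun_prop) (by fun_prop) hd))

end Invariance

/-! ### Separating the Kloosterman phase from the integral. -/

section KeyIdentity

theorem mul_abs_div_eq {c d : ℝ} (hc : c ≠ 0) (hd : d ≠ 0) :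
    c * |d / c| = d * Real.sign (c * d) := by
  rw [abs_div]
  rcases lt_or_gt_of_ne hc with h1 | h1 <;> rcases lt_or_gt_of_ne hd with h2 | h2
  · rw [abs_of_neg h1, abs_of_neg h2, Real.sign_of_pos (mul_pos_of_neg_of_neg h1 h2)]
    field_simp
  · rw [abs_of_neg h1, abs_of_pos h2, Real.sign_of_neg (mul_neg_of_neg_of_pos h1 h2)]
    field_simp
  · rw [abs_of_pos h1, abs_of_neg h2, Real.sign_of_neg (mul_neg_of_pos_of_neg h1 h2)]
    field_simp
  · rw [abs_of_pos h1, abs_of_pos h2, Real.sign_of_pos (mul_pos h1 h2)]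
    field_simp

/-- After the translation by `log |d / c|`, the term of `M` depends, up to a constant factor, only
on the product `cd`. -/
theorem stripTerm_mul_exp_eq {k : ℕ} (hk : Even k) (m n : ℤ) (ℓ : ℝ) {M : SL(2, ℝ)}
    (hM : lowerProd M ≠ 0) {u : ℂ} (h0 : 0 < u.im) (hπ : u.im < Real.pi) :
    stripTerm k m M (u + Real.log |M 1 1 / M 1 0|) *
        Complex.exp (-(2 * Real.pi * Complex.I * n / ℓ) * (u + Real.log |M 1 1 / M 1 0|)) / ℓ =
      ((|lowerProd M| ^ (k / 2))⁻¹ : ℂ) * kloostermanTerm ℓ m n M *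
        parHypIntegrand k ℓ m n (lowerProd M) u := by
  have hc : M 1 0 ≠ 0 := left_ne_zero_of_mul hM
  have hd : M 1 1 ≠ 0 := right_ne_zero_of_mul hM
  have hden : (M 1 0 * Complex.exp (u + Real.log |M 1 1 / M 1 0|) + M 1 1 : ℂ) ≠ 0 :=
    denom_ne_zero M (exp_im_pos (by simpa using h0) (by simpa using hπ))
  obtain ⟨l, rfl⟩ := hk
  have hl : (l + l) / 2 = l := by omega
  have hlog : Real.log |M 1 0 / M 1 1| = -Real.log |M 1 1 / M 1 0| := by
    rw [← Real.log_inv, ← abs_inv, inv_div]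
  have habs : (0 : ℝ) < |M 1 1 / M 1 0| := abs_pos.2 (div_ne_zero hd hc)
  have hexpL : Complex.exp (Real.log |M 1 1 / M 1 0|) = (|M 1 1 / M 1 0| : ℝ) := by
    rw [← Complex.ofReal_exp, Real.exp_log habs]
  have hkey : (M 1 0 : ℂ) * Complex.exp (u + Real.log |M 1 1 / M 1 0|) =
      M 1 1 * (Real.sign (lowerProd M) * Complex.exp u) := by
    have h := mul_abs_div_eq hc hd
    rw [Complex.exp_add, hexpL]
    have h' : (M 1 0 : ℂ) * (|M 1 1 / M 1 0| : ℝ) = M 1 1 * Real.sign (lowerProd M) := by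
      rw [lowerProd]; exact_mod_cast h
    linear_combination Complex.exp u * h'
  have hpow : Complex.exp (Real.log |M 1 1 / M 1 0| * l) = ((|M 1 1 / M 1 0| : ℝ) : ℂ) ^ l := by
    rw [mul_comm, Complex.exp_nat_mul, hexpL]
  -- The shifted weight factor |d/c|^(k/2) and the factor d^(-k) from the denominator combine to
  -- |cd|^(-k/2).
  have hdl : ((|M 1 1 / M 1 0| : ℝ) : ℂ) ^ l / (M 1 1 : ℂ) ^ (l + l) =
      ((|lowerProd M| ^ l)⁻¹ : ℂ) := by
    have h1 : (|M 1 1 / M 1 0|) ^ l / (M 1 1) ^ (l + l) = (|lowerProd M| ^ l)⁻¹ := by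
      have e1 : (M 1 1) ^ (l + l) = |M 1 1| ^ l * |M 1 1| ^ l := by
        rw [← mul_pow, abs_mul_abs_self, mul_pow, pow_add]
      have hc' := abs_pos.2 hc
      have hd' := abs_pos.2 hd
      rw [e1, lowerProd, abs_mul, abs_div, div_pow, mul_pow]
      field_simp
    have h2 := congrArg (fun x : ℝ => (x : ℂ)) h1
    push_cast at h2
    exact_mod_cast h2
  set L := Real.log |M 1 1 / M 1 0| with hL
  set w := (Real.sign (lowerProd M) * Complex.exp u : ℂ) with hw
  have hcC : (M 1 0 : ℂ) ≠ 0 := by exact_mod_cast hc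
  have hdC : (M 1 1 : ℂ) ≠ 0 := by exact_mod_cast hd
  have hw1 : w + 1 ≠ 0 := by
    intro h
    apply hden
    rw [hkey]
    linear_combination (M 1 1 : ℂ) * h
  have hE : Complex.exp (u + L) = M 1 1 * w / M 1 0 := by
    rw [← hkey]; field_simp
  have hdet : (M 0 0 * M 1 1 - M 0 1 * M 1 0 : ℂ) = 1 := by exact_mod_cast det_entries M
  -- In terms of w the Möbius map takes the values b/d at 0 and a/c at ∞. Splitting off their mean
  -- leaves a function of cd and w alone.
  have hmob : (M 0 0 * Complex.exp (u + L) + M 0 1) / (M 1 0 * Complex.exp (u + L) + M 1 1) =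
      (M 0 0 / (2 * M 1 0) + M 0 1 / (2 * M 1 1)) +
        (w - 1) / (2 * (lowerProd M : ℝ) * (w + 1)) := by
    rw [hkey, hE, lowerProd]
    push_cast
    have : (M 1 1 * w + M 1 1 : ℂ) ≠ 0 := by
      rw [show (M 1 1 * w + M 1 1 : ℂ) = M 1 1 * (w + 1) by ring]
      exact mul_ne_zero hdC hw1
    field_simp
    linear_combination (w - 1) * hdet
  have hparts : kloostermanTerm ℓ m n M = e (m * (M 0 0 / (2 * M 1 0) + M 0 1 / (2 * M 1 1))) *
      Complex.exp (-(2 * Real.pi * Complex.I * n / ℓ) * L) := by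
    rw [kloostermanTerm, hlog]
    push_cast
    rw [e_add]
    congr 1
    rw [e]
    congr 1
    ring
  rw [stripTerm, slashTerm, hmob, hkey, mul_add, e_add, hparts, parHypIntegrand, ← hw, hl, ← hdl,
    show (M 1 1 * w + M 1 1 : ℂ) = M 1 1 * (w + 1) by ring, mul_pow, mul_add _ u, Complex.exp_add
      (_ * u), ← hpow]
  have e2 : Complex.exp ((u + L) * (((l + l : ℕ) : ℂ) / 2)) =
      Complex.exp (u * (((l + l : ℕ) : ℂ) / 2)) * Complex.exp (L * l) := by
    rw [← Complex.exp_add]; congr 1; push_cast; ring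
  have e3 : Complex.exp (u * (((l + l : ℕ) : ℂ) / 2 - 2 * Real.pi * Complex.I * n / ℓ)) =
      Complex.exp (u * (((l + l : ℕ) : ℂ) / 2)) *
        Complex.exp (-(2 * Real.pi * Complex.I * n / ℓ) * u) := by
    rw [← Complex.exp_add]; congr 1; ring
  rw [e2, e3]
  have := pow_ne_zero (l + l) hw1
  have := pow_ne_zero (l + l) hdC
  field_simp

end KeyIdentity

/-! ### Unfolding of integrals and Fourier series of period 1. -/

section Fourier

/-- The bound on one period permits termwise integration over Q × ℤ; for fixed q the unit intervals
then fill the real line. -/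
theorem hasSum_integral_unfold {Q E : Type*} [Countable Q] [NormedAddCommGroup E]
    [NormedSpace ℝ E] [CompleteSpace E] {H : Q → ℝ → E} (hc : ∀ q, Continuous (H q))
    (hi : ∀ q, Integrable (H q)) {b : Q × ℤ → ℝ} (hb : Summable b)
    (hle : ∀ q j, ∀ x ∈ Set.Icc (0 : ℝ) 1, ‖H q (x + (j : ℤ))‖ ≤ b (q, j)) :
    HasSum (fun q => ∫ x, H q x) (∫ x in (0 : ℝ)..1, ∑' p : Q × ℤ, H p.1 (x + p.2)) := by
  have hmem : ∀ {x : ℝ}, x ∈ Set.uIoc (0 : ℝ) 1 → x ∈ Set.Icc (0 : ℝ) 1 := by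
    intro x hx
    rw [Set.uIoc_of_le zero_le_one] at hx
    exact Set.Ioc_subset_Icc_self hx
  have h := intervalIntegral.hasSum_integral_of_dominated_convergence (μ := volume)
    (a := (0 : ℝ)) (b := 1) (F := fun (p : Q × ℤ) (x : ℝ) => H p.1 (x + p.2))
    (f := fun x => ∑' p : Q × ℤ, H p.1 (x + p.2)) (fun p _ => b p)
    (fun p => ((hc p.1).comp (by fun_prop)).aestronglyMeasurable)
    (fun p => Eventually.of_forall fun x hx => hle p.1 p.2 x (hmem hx))
    (Eventually.of_forall fun x _ => hb) intervalIntegrable_const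
    (Eventually.of_forall fun x hx =>
      (Summable.of_norm_bounded hb fun p => hle p.1 p.2 x (hmem hx)).hasSum)
  exact h.prod_fiberwise fun q => (hi q).hasSum_intervalIntegral_comp_add_int

/-- The Fourier coefficients of a function of period `1`. -/
def periodicCoeff (F : ℝ → ℂ) (n : ℤ) : ℂ :=
  ∫ x in (0 : ℝ)..1, F x * Complex.exp (-(2 * Real.pi * Complex.I * n) * x)

theorem hasSum_periodicCoeff {F : ℝ → ℂ} (hF : Continuous F) (hper : Function.Periodic F 1)
    (hs : Summable (periodicCoeff F)) (x : ℝ) :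
    HasSum (fun n => periodicCoeff F n * Complex.exp (2 * Real.pi * Complex.I * n * x)) (F x) := by
  let f : C(UnitAddCircle, ℂ) := ⟨hper.lift, continuous_coinduced_dom.2 hF⟩
  have hcoef : ∀ n, fourierCoeff f n = periodicCoeff F n := by
    intro n
    rw [fourierCoeff_eq_intervalIntegral _ n 0, periodicCoeff]
    simp only [div_one, one_smul, zero_add]
    refine intervalIntegral.integral_congr fun x _ => ?_
    simp only [fourier_coe_apply, smul_eq_mul]
    rw [mul_comm]
    congr 1
    congr 1
    push_cast; ring
  have hs' : Summable (fourierCoeff f) := by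
    convert hs using 1
    ext n; exact hcoef n
  have h := has_pointwise_sum_fourier_series_of_summable hs' (x : UnitAddCircle)
  convert h using 1
  swap
  · exact (hper.lift_coe x).symm
  ext n
  rw [hcoef, fourier_coe_apply, smul_eq_mul]
  congr 2
  push_cast; ring

theorem integral_exp_int (j : ℤ) :
    ∫ x in (0 : ℝ)..1, Complex.exp (2 * Real.pi * Complex.I * j * x) = if j = 0 then 1 else 0 := by
  split_ifs with h
  · simp [h]
  · rw [integral_exp_mul_complex (by simp [h, Real.pi_ne_zero])]
    have : Complex.exp (2 * Real.pi * Complex.I * j) = 1 := by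
      rw [← e, e_intCast]
    simp [this]

/-- Summability at x = 0 already makes the coefficients absolutely summable, so orthogonality can be
applied term by term. -/
theorem periodicCoeff_eq_of_hasSum {F : ℝ → ℂ} {a : ℤ → ℂ}
    (h : ∀ x : ℝ, HasSum (fun n => a n * Complex.exp (2 * Real.pi * Complex.I * n * x)) (F x)) :
    periodicCoeff F = a := by
  ext n
  have hs : Summable fun j => ‖a j‖ := by
    have := (h 0).summable.norm
    simpa using this
  have hnorm : ∀ (j : ℤ) (x : ℝ), ‖Complex.exp (2 * Real.pi * Complex.I * j * x)‖ = 1 := by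
    intro j x
    rw [show (2 * Real.pi * Complex.I * j * x : ℂ) = ((2 * Real.pi * j * x : ℝ) : ℂ) * Complex.I by
      push_cast; ring, Complex.norm_exp_ofReal_mul_I]
  have h1 := intervalIntegral.hasSum_integral_of_dominated_convergence (μ := volume)
    (a := (0 : ℝ)) (b := 1)
    (F := fun (j : ℤ) (x : ℝ) => a j * Complex.exp (2 * Real.pi * Complex.I * j * x) *
      Complex.exp (-(2 * Real.pi * Complex.I * n) * x))
    (f := fun x => F x * Complex.exp (-(2 * Real.pi * Complex.I * n) * x)) (fun j _ => ‖a j‖)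
    (fun j => (by fun_prop : Continuous _).aestronglyMeasurable)
    (fun j => Eventually.of_forall fun x _ => by
      have e1 : (-(2 * Real.pi * Complex.I * n) * x : ℂ) =
        2 * Real.pi * Complex.I * ((-n : ℤ) : ℂ) * x := by push_cast; ring
      rw [norm_mul, norm_mul, hnorm, e1, hnorm, mul_one, mul_one])
    (Eventually.of_forall fun x _ => hs) intervalIntegrable_const
    (Eventually.of_forall fun x _ => (h x).mul_right _)
  have h2 : ∀ j : ℤ, ∫ x in (0 : ℝ)..1, a j * Complex.exp (2 * Real.pi * Complex.I * j * x) *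
      Complex.exp (-(2 * Real.pi * Complex.I * n) * x) = if j = n then a n else 0 := by
    intro j
    have e1 : ∀ x : ℝ, a j * Complex.exp (2 * Real.pi * Complex.I * j * x) *
        Complex.exp (-(2 * Real.pi * Complex.I * n) * x) =
        a j * Complex.exp (2 * Real.pi * Complex.I * ((j - n : ℤ) : ℂ) * x) := by
      intro x
      rw [mul_assoc, ← Complex.exp_add]
      congr 2
      push_cast; ring
    simp only [e1]
    rw [intervalIntegral.integral_const_mul, integral_exp_int]
    by_cases hj : j = n
    · simp [hj]
    · simp [hj, sub_eq_zero]
  simp only [h2] at h1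
  exact h1.unique (hasSum_ite_eq n (a n))

end Fourier

end

/-! ### The Poincaré series on a horizontal line of the strip. -/

section

open MeasureTheory Filter Topology

variable {Γ : Subgroup SL(2, ℝ)} {𝔞 η₁ η₂ : OnePoint ℝ} {σ ση : SL(2, ℝ)} {ℓ : ℝ} {k : ℕ}
  {m n : ℤ} {y : ℝ}

/-- The point `ℓx + iy`. -/
def linePoint (ℓ y x : ℝ) : ℂ := (ℓ * x : ℝ) + y * Complex.I

@[simp] theorem linePoint_im (ℓ y x : ℝ) : (linePoint ℓ y x).im = y := by simp [linePoint]

theorem continuous_linePoint (ℓ y : ℝ) : Continuous (linePoint ℓ y) := by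
  unfold linePoint; fun_prop

/-- The function `e ^ (ku/2) (P_{𝔞,m} |_k σ_η)(e ^ u)` at `u = ℓx + iy`. -/
def lineSeries (Γ : Subgroup SL(2, ℝ)) (𝔞 : OnePoint ℝ) (σ ση : SL(2, ℝ)) (ℓ : ℝ) (k : ℕ) (m : ℤ)
    (y x : ℝ) : ℂ :=
  ∑' p : CuspCosets Γ 𝔞, stripTerm k m (σ⁻¹ * (p.out : Γ) * ση) (linePoint ℓ y x)

/-- For |x| ≤ X the points e^u satisfy |e^u| ≤ e^(ℓX) and Im e^u ≥ e^(-ℓX) sin y, a region where the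
Poincaré series is uniformly dominated. -/
theorem exists_stripTerm_bound (hΓ : DiscreteTopology Γ) (hσ : IsCuspScaling Γ 𝔞 σ) (hk : Even k)
    (hk4 : 4 ≤ k) (m : ℤ) (ση : SL(2, ℝ)) (hℓ : 0 < ℓ) (hy : 0 < y) (hyπ : y < Real.pi)
    (X : ℝ) :
    ∃ b : CuspCosets Γ 𝔞 → ℝ, Summable b ∧ ∀ p (x : ℝ), |x| ≤ X →
      ‖stripTerm k m (σ⁻¹ * (p.out : Γ) * ση) (linePoint ℓ y x)‖ ≤ b p := by
  have hsin := Real.sin_pos_of_pos_of_lt_pi hy hyπ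
  obtain ⟨b, hb, h⟩ := exists_summable_bound hΓ hσ hk hk4 m ση
    (Real.exp_pos (ℓ * X)).le (mul_pos (Real.exp_pos (-(ℓ * X))) hsin)
  refine ⟨fun p => b p * Real.exp (ℓ * X * (k / 2)), hb.mul_right _, fun p x hx => ?_⟩
  have hx' := abs_le.1 hx
  have h1 : ℓ * x ≤ ℓ * X := mul_le_mul_of_nonneg_left hx'.2 hℓ.le
  have h2 : -(ℓ * X) ≤ ℓ * x := by nlinarith
  have hre : (linePoint ℓ y x).re = ℓ * x := by simp [linePoint]
  have h3 := h p (Complex.exp (linePoint ℓ y x))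
    (by rw [Complex.norm_exp, hre]; exact Real.exp_le_exp.2 h1)
    (by
      rw [Complex.exp_im, hre, linePoint_im]
      gcongr)
  rw [stripTerm, norm_mul]
  refine mul_le_mul h3 ?_ (norm_nonneg _) ((norm_nonneg _).trans h3)
  rw [Complex.norm_exp, Real.exp_le_exp]
  have e1 : (linePoint ℓ y x * (k / 2)).re = ℓ * x * (k / 2) := by
    rw [show ((k : ℂ) / 2) = ((k / 2 : ℝ) : ℂ) by push_cast; rfl, Complex.re_mul_ofReal, hre]
  rw [e1]
  gcongr

theorem continuous_stripTerm_line (M : SL(2, ℝ)) (hy : 0 < y) (hyπ : y < Real.pi) :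
    Continuous fun x => stripTerm k m M (linePoint ℓ y x) :=
  (continuousOn_stripTerm M).comp_continuous (continuous_linePoint ℓ y) fun x => by simp [hy, hyπ]

theorem continuous_lineSeries (hΓ : DiscreteTopology Γ) (hσ : IsCuspScaling Γ 𝔞 σ) (hk : Even k)
    (hk4 : 4 ≤ k) (m : ℤ) (ση : SL(2, ℝ)) (hℓ : 0 < ℓ) (hy : 0 < y) (hyπ : y < Real.pi) :
    Continuous (lineSeries Γ 𝔞 σ ση ℓ k m y) := by
  rw [continuous_iff_continuousAt]
  intro x₀
  obtain ⟨b, hb, h⟩ := exists_stripTerm_bound hΓ hσ hk hk4 m ση hℓ hy hyπ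
    (|x₀| + 1)
  have hc : ContinuousOn (lineSeries Γ 𝔞 σ ση ℓ k m y) {x | |x| ≤ |x₀| + 1} :=
    continuousOn_tsum (fun p => (continuous_stripTerm_line _ hy hyπ).continuousOn) hb
      fun p x hx => h p x hx
  refine hc.continuousAt ?_
  have : ∀ᶠ x in 𝓝 x₀, |x| < |x₀| + 1 :=
    (continuous_abs.tendsto x₀).eventually (gt_mem_nhds (by linarith))
  filter_upwards [this] with x hx using hx.le

theorem stripTerm_cosetOf_line (hk : Even k) (hσ : IsCuspScaling Γ 𝔞 σ)
    (hη : IsHyperbolicScaling Γ η₁ η₂ ση ℓ) (hy : 0 < y) (hyπ : y < Real.pi)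
    (p : DoubleCosets Γ 𝔞 η₁ η₂ × ℤ) (x : ℝ) :
    stripTerm k m (σ⁻¹ * ((cosetOf hη p).out : Γ) * ση) (linePoint ℓ y x) =
      stripTerm k m (repMatrix σ ση p.1) (linePoint ℓ y (x + p.2)) := by
  rw [stripTerm_cosetOf hk hσ hη p (by simpa using hy) (by simpa using hyπ)]
  congr 1
  simp only [linePoint]
  push_cast; ring

/-- The parametrization of `Γ_𝔞 \ Γ` by `Γ_𝔞 \ Γ / Γ_η` and the powers of a generator. -/
def cosetEquiv (hσ : IsCuspScaling Γ 𝔞 σ) (hη : IsHyperbolicScaling Γ η₁ η₂ ση ℓ) :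
    DoubleCosets Γ 𝔞 η₁ η₂ × ℤ ≃ CuspCosets Γ 𝔞 :=
  Equiv.ofBijective (cosetOf hη) ⟨cosetOf_injective hσ hη, cosetOf_surjective hσ hη⟩

theorem lineSeries_eq_tsum (hk : Even k) (hσ : IsCuspScaling Γ 𝔞 σ)
    (hη : IsHyperbolicScaling Γ η₁ η₂ ση ℓ) (hy : 0 < y) (hyπ : y < Real.pi) (x : ℝ) :
    lineSeries Γ 𝔞 σ ση ℓ k m y x = ∑' p : DoubleCosets Γ 𝔞 η₁ η₂ × ℤ,
      stripTerm k m (repMatrix σ ση p.1) (linePoint ℓ y (x + p.2)) := by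
  rw [lineSeries, ← (cosetEquiv hσ hη).tsum_eq]
  exact tsum_congr fun p => stripTerm_cosetOf_line hk hσ hη hy hyπ p x

/-- Adding a period only shifts the ℤ-coordinate of the index. -/
theorem periodic_lineSeries (hk : Even k) (hσ : IsCuspScaling Γ 𝔞 σ)
    (hη : IsHyperbolicScaling Γ η₁ η₂ ση ℓ) (hy : 0 < y) (hyπ : y < Real.pi) :
    Function.Periodic (lineSeries Γ 𝔞 σ ση ℓ k m y) 1 := by
  intro x
  rw [lineSeries_eq_tsum hk hσ hη hy hyπ, lineSeries_eq_tsum hk hσ hη hy hyπ,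
    ← ((Equiv.refl (DoubleCosets Γ 𝔞 η₁ η₂)).prodCongr (Equiv.addLeft (1 : ℤ))).tsum_eq
      (fun p => stripTerm k m (repMatrix σ ση p.1) (linePoint ℓ y (x + p.2)))]
  refine tsum_congr fun p => ?_
  simp [add_assoc]

/-! ### Fourier coefficients as sums over double cosets. -/

section Unfolding

/-- The function on the line `Im u = y`, rescaled by `ℓ`, whose integral is the contribution of
a double coset to the `n`-th coefficient. -/
def unfoldedTerm (k : ℕ) (m n : ℤ) (ℓ y : ℝ) (M : SL(2, ℝ)) (x : ℝ) : ℂ :=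
  stripTerm k m M (linePoint ℓ y x) *
    Complex.exp (-(2 * Real.pi * Complex.I * n / ℓ) * linePoint ℓ y x)

theorem continuous_unfoldedTerm (M : SL(2, ℝ)) (hy : 0 < y) (hyπ : y < Real.pi) :
    Continuous (unfoldedTerm k m n ℓ y M) :=
  (continuous_stripTerm_line M hy hyπ).mul (by have := continuous_linePoint ℓ y; fun_prop)

theorem exp_linePoint (hℓ : 0 < ℓ) (n : ℤ) (y x : ℝ) :
    Complex.exp (-(2 * Real.pi * Complex.I * n / ℓ) * linePoint ℓ y x) =
      Complex.exp ((2 * Real.pi * n * y / ℓ : ℝ)) *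
        Complex.exp (-(2 * Real.pi * Complex.I * n) * x) := by
  have : (ℓ : ℂ) ≠ 0 := by exact_mod_cast hℓ.ne'
  rw [← Complex.exp_add]
  congr 1
  rw [linePoint]
  push_cast
  field_simp
  linear_combination (-(y * n) : ℂ) * Complex.I_sq

theorem exp_linePoint_add_int (hℓ : 0 < ℓ) (n j : ℤ) (y x : ℝ) :
    Complex.exp (-(2 * Real.pi * Complex.I * n / ℓ) * linePoint ℓ y (x + j)) =
      Complex.exp (-(2 * Real.pi * Complex.I * n / ℓ) * linePoint ℓ y x) := by
  rw [exp_linePoint hℓ, exp_linePoint hℓ]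
  congr 1
  have e1 : (-(2 * Real.pi * Complex.I * n) * ((x + j : ℝ) : ℂ)) =
      -(2 * Real.pi * Complex.I * n) * x + ((-(n * j) : ℤ) : ℂ) * (2 * Real.pi * Complex.I) := by
    push_cast; ring
  rw [e1, Complex.exp_add, Complex.exp_int_mul_two_pi_mul_I, mul_one]

theorem unfoldedTerm_eq (hk : Even k) {M : SL(2, ℝ)} (hM : lowerProd M ≠ 0) (hℓ : 0 < ℓ)
    (hy : 0 < y) (hyπ : y < Real.pi) (x : ℝ) :
    unfoldedTerm k m n ℓ y M x = ℓ * (((|lowerProd M| ^ (k / 2))⁻¹ : ℂ) *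
      kloostermanTerm ℓ m n M * parHypIntegrand k ℓ m n (lowerProd M)
        ((ℓ * x - Real.log |M 1 1 / M 1 0| : ℝ) + y * Complex.I)) := by
  have h := stripTerm_mul_exp_eq hk m n ℓ hM
    (u := (ℓ * x - Real.log |M 1 1 / M 1 0| : ℝ) + y * Complex.I) (by simpa using hy)
    (by simpa using hyπ)
  have e1 : ((ℓ * x - Real.log |M 1 1 / M 1 0| : ℝ) + y * Complex.I +
      Real.log |M 1 1 / M 1 0| : ℂ) = linePoint ℓ y x := by
    rw [linePoint]; push_cast; ring
  have : (ℓ : ℂ) ≠ 0 := by exact_mod_cast hℓ.ne'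
  rw [← h, e1, unfoldedTerm]
  field_simp

theorem integrable_unfoldedTerm (hk : Even k) (hk4 : 4 ≤ k) {M : SL(2, ℝ)}
    (hM : lowerProd M ≠ 0) (hℓ : 0 < ℓ) (hy : 0 < y) (hyπ : y < Real.pi) :
    Integrable (unfoldedTerm k m n ℓ y M) := by
  have h := integrable_parHypIntegrand (k := k) (ℓ := ℓ) (m := m) (n := n) (by omega) hM hy hyπ
  rw [funext (unfoldedTerm_eq hk hM hℓ hy hyπ)]
  exact (((h.comp_sub_right (Real.log |M 1 1 / M 1 0|)).comp_mul_left' hℓ.ne').const_mul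
    _).const_mul _

theorem integral_unfoldedTerm (hk : Even k) {M : SL(2, ℝ)}
    (hM : lowerProd M ≠ 0) (hℓ : 0 < ℓ) (hy : 0 < y) (hyπ : y < Real.pi) :
    ∫ x, unfoldedTerm k m n ℓ y M x = ((|lowerProd M| ^ (k / 2))⁻¹ : ℂ) *
      parHypIntegral k ℓ m n (lowerProd M) y * kloostermanTerm ℓ m n M := by
  simp only [unfoldedTerm_eq hk hM hℓ hy hyπ]
  rw [integral_const_mul, integral_const_mul,
    Measure.integral_comp_mul_left (fun t : ℝ => parHypIntegrand k ℓ m n (lowerProd M)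
      ((t - Real.log |M 1 1 / M 1 0| : ℝ) + y * Complex.I)) ℓ,
    integral_sub_right_eq_self (fun t : ℝ => parHypIntegrand k ℓ m n (lowerProd M)
      (t + y * Complex.I)), abs_of_pos (inv_pos.2 hℓ), Complex.real_smul, parHypIntegral]
  have : (ℓ : ℂ) ≠ 0 := by exact_mod_cast hℓ.ne'
  push_cast
  field_simp

theorem norm_kloostermanTerm (ℓ : ℝ) (m n : ℤ) (M : SL(2, ℝ)) : ‖kloostermanTerm ℓ m n M‖ = 1 := by
  rw [kloostermanTerm, norm_e, Complex.ofReal_im]; simp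

theorem integral_norm_unfoldedTerm (hk : Even k) {M : SL(2, ℝ)}
    (hM : lowerProd M ≠ 0) (hℓ : 0 < ℓ) (hy : 0 < y) (hyπ : y < Real.pi) :
    ∫ x, ‖unfoldedTerm k m n ℓ y M x‖ = (|lowerProd M| ^ (k / 2))⁻¹ *
      ∫ t : ℝ, ‖parHypIntegrand k ℓ m n (lowerProd M) (t + y * Complex.I)‖ := by
  simp only [unfoldedTerm_eq hk hM hℓ hy hyπ, norm_mul, norm_kloostermanTerm, norm_inv, norm_pow,
    Complex.norm_real, Real.norm_eq_abs, abs_abs, mul_one]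
  rw [integral_const_mul, integral_const_mul,
    Measure.integral_comp_mul_left (fun t : ℝ => ‖parHypIntegrand k ℓ m n (lowerProd M)
      ((t - Real.log |M 1 1 / M 1 0| : ℝ) + y * Complex.I)‖) ℓ,
    integral_sub_right_eq_self (fun t : ℝ => ‖parHypIntegrand k ℓ m n (lowerProd M)
      (t + y * Complex.I)‖), abs_of_pos (inv_pos.2 hℓ), smul_eq_mul, abs_of_pos hℓ]
  field_simp

theorem exists_unfoldedTerm_bound (hΓ : DiscreteTopology Γ) (hσ : IsCuspScaling Γ 𝔞 σ)
    (hk : Even k) (hk4 : 4 ≤ k) (m n : ℤ) (hη : IsHyperbolicScaling Γ η₁ η₂ ση ℓ) (hy : 0 < y)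
    (hyπ : y < Real.pi) :
    ∃ b : DoubleCosets Γ 𝔞 η₁ η₂ × ℤ → ℝ, Summable b ∧ ∀ q (j : ℤ), ∀ x ∈ Set.Icc (0 : ℝ) 1,
      ‖unfoldedTerm k m n ℓ y (repMatrix σ ση q) (x + j)‖ ≤ b (q, j) := by
  obtain ⟨b, hb, h⟩ := exists_stripTerm_bound hΓ hσ hk hk4 m ση hη.length_pos hy hyπ
    1
  refine ⟨fun p => b (cosetOf hη p) * Real.exp (2 * Real.pi * n * y / ℓ),
    ((cosetEquiv hσ hη).summable_iff.2 hb).mul_right _, fun q j x hx => ?_⟩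
  have h1 := h (cosetOf hη (q, j)) x (abs_le.2 ⟨by linarith [hx.1], hx.2⟩)
  rw [stripTerm_cosetOf_line hk hσ hη hy hyπ] at h1
  rw [unfoldedTerm, exp_linePoint_add_int hη.length_pos, exp_linePoint hη.length_pos, norm_mul,
    norm_mul]
  have e1 : ‖Complex.exp (-(2 * Real.pi * Complex.I * n) * x)‖ = 1 := by
    rw [show (-(2 * Real.pi * Complex.I * n) * x : ℂ) =
      ((-(2 * Real.pi * n * x) : ℝ) : ℂ) * Complex.I by push_cast; ring,
      Complex.norm_exp_ofReal_mul_I]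
  rw [e1, mul_one, Complex.norm_exp, Complex.ofReal_re]
  exact mul_le_mul_of_nonneg_right h1 (Real.exp_pos _).le

/-- A summable family without zero terms has a countable index set. Countability is needed for
exchanging sum and integral. -/
theorem countable_cuspCosets (hΓ : DiscreteTopology Γ) (hσ : IsCuspScaling Γ 𝔞 σ) :
    Countable (CuspCosets Γ 𝔞) := by
  have h := (summable_rowSq hΓ hσ 1).countable_support
  rw [Function.support_eq_univ fun p => pow_ne_zero 2 (inv_ne_zero (rowSq_pos _).ne')] at h
  exact Set.countable_univ_iff.1 h

theorem countable_doubleCosets (hΓ : DiscreteTopology Γ) (hσ : IsCuspScaling Γ 𝔞 σ)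
    (hη : IsHyperbolicScaling Γ η₁ η₂ ση ℓ) : Countable (DoubleCosets Γ 𝔞 η₁ η₂) := by
  have := countable_cuspCosets hΓ hσ
  exact Function.Injective.countable (f := fun q => cosetOf (𝔞 := 𝔞) hη (q, 0)) fun q q' h =>
    congrArg Prod.fst (cosetOf_injective hσ hη h)

theorem lowerProd_repMatrix_ne_zero (hσ : IsCuspScaling Γ 𝔞 σ)
    (hη : IsHyperbolicScaling Γ η₁ η₂ ση ℓ) (q : DoubleCosets Γ 𝔞 η₁ η₂) :
    lowerProd (repMatrix σ ση q) ≠ 0 := lowerProd_ne_zero hσ hη _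

/-- The exponential is unchanged under x ↦ x + j, so it factors out of the sum over (q, j) and
leaves `lineSeries`. Its modulus at height y is the factor e^(2πny/ℓ). -/
theorem hasSum_integral_unfoldedTerm (hΓ : DiscreteTopology Γ) (hσ : IsCuspScaling Γ 𝔞 σ)
    (hk : Even k) (hk4 : 4 ≤ k) (m n : ℤ) (hη : IsHyperbolicScaling Γ η₁ η₂ ση ℓ) (hy : 0 < y)
    (hyπ : y < Real.pi) :
    HasSum (fun q : DoubleCosets Γ 𝔞 η₁ η₂ =>
        ∫ x, unfoldedTerm k m n ℓ y (repMatrix σ ση q) x)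
      (Complex.exp ((2 * Real.pi * n * y / ℓ : ℝ)) *
        periodicCoeff (lineSeries Γ 𝔞 σ ση ℓ k m y) n) := by
  have := countable_doubleCosets hΓ hσ hη
  obtain ⟨b, hb, h⟩ := exists_unfoldedTerm_bound hΓ hσ hk hk4 m n hη hy hyπ
  convert! hasSum_integral_unfold (H := fun q => unfoldedTerm k m n ℓ y (repMatrix σ ση q))
    (fun q => continuous_unfoldedTerm _ hy hyπ)
    (fun q => integrable_unfoldedTerm hk hk4 (lowerProd_repMatrix_ne_zero hσ hη q) hη.length_pos
      hy hyπ) hb h using 1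
  rw [periodicCoeff, ← intervalIntegral.integral_const_mul]
  refine intervalIntegral.integral_congr fun x _ => ?_
  simp only [unfoldedTerm, exp_linePoint_add_int hη.length_pos]
  rw [tsum_mul_right, ← lineSeries_eq_tsum hk hσ hη hy hyπ, exp_linePoint hη.length_pos]
  ring

theorem summable_integral_norm_unfoldedTerm (hΓ : DiscreteTopology Γ) (hσ : IsCuspScaling Γ 𝔞 σ)
    (hk : Even k) (hk4 : 4 ≤ k) (m n : ℤ) (hη : IsHyperbolicScaling Γ η₁ η₂ ση ℓ) (hy : 0 < y)
    (hyπ : y < Real.pi) :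
    Summable fun q : DoubleCosets Γ 𝔞 η₁ η₂ =>
      ∫ x, ‖unfoldedTerm k m n ℓ y (repMatrix σ ση q) x‖ := by
  have := countable_doubleCosets hΓ hσ hη
  obtain ⟨b, hb, h⟩ := exists_unfoldedTerm_bound hΓ hσ hk hk4 m n hη hy hyπ
  exact (hasSum_integral_unfold (H := fun q x => ‖unfoldedTerm k m n ℓ y (repMatrix σ ση q) x‖)
    (fun q => (continuous_unfoldedTerm _ hy hyπ).norm)
    (fun q => (integrable_unfoldedTerm hk hk4 (lowerProd_repMatrix_ne_zero hσ hη q) hη.length_pos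
      hy hyπ).norm) hb (by simpa using h)).summable

end Unfolding

/-! ### Finiteness of Kloosterman sums and grouping by C. -/

section Kloosterman

theorem parHypIntegrand_ne_zero {r : ℝ} (hr : r ≠ 0) (hℓ : 0 < ℓ) (hy : 0 < y)
    (hyπ : y < Real.pi) (t : ℝ) : parHypIntegrand k ℓ m n r (t + y * Complex.I) ≠ 0 := by
  have hℓ' : (ℓ : ℂ) ≠ 0 := by exact_mod_cast hℓ.ne'
  have h1 := one_add_exp_ne_zero (u := t + ((y - signArg r : ℝ) : ℂ) * Complex.I)
    (by simpa using abs_sub_signArg_lt hy hyπ r)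
  rw [parHypIntegrand_line hr hy hyπ, e, betaKernel]
  have := pow_ne_zero k h1
  simp only [ne_eq, mul_eq_zero, div_eq_zero_iff, Complex.exp_ne_zero, hℓ', this, or_self,
    not_false_eq_true]

/-- All double cosets with the same C contribute the same positive L¹ norm to a convergent series.
The statement involves no weight, so k = 4 and m = n = 0 may be taken. -/
theorem finite_kloostermanIndex (hΓ : DiscreteTopology Γ) (hσ : IsCuspScaling Γ 𝔞 σ)
    (hη : IsHyperbolicScaling Γ η₁ η₂ ση ℓ) (C : ℝ) :
    (kloostermanIndex Γ 𝔞 η₁ η₂ σ ση C).Finite := by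
  by_contra hinf
  have hinf' : (kloostermanIndex Γ 𝔞 η₁ η₂ σ ση C).Infinite := hinf
  have : Infinite (kloostermanIndex Γ 𝔞 η₁ η₂ σ ση C) := hinf'.to_subtype
  have hpi := Real.pi_pos
  have hy : 0 < Real.pi / 2 := by positivity
  have hyπ : Real.pi / 2 < Real.pi := by linarith
  have h4 : Even 4 := by decide
  have hC : C ≠ 0 := by
    obtain ⟨q, hq⟩ := hinf'.nonempty
    rw [← show lowerProd (repMatrix σ ση q) = C from hq]
    exact lowerProd_repMatrix_ne_zero hσ hη q
  have hs := (summable_integral_norm_unfoldedTerm hΓ hσ h4 le_rfl 0 0 hη hy hyπ).comp_injective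
    (Subtype.val_injective (p := (· ∈ kloostermanIndex Γ 𝔞 η₁ η₂ σ ση C)))
  have hconst : ∀ q : kloostermanIndex Γ 𝔞 η₁ η₂ σ ση C,
      ∫ x, ‖unfoldedTerm 4 0 0 ℓ (Real.pi / 2) (repMatrix σ ση q.1) x‖ = (|C| ^ (4 / 2))⁻¹ *
        ∫ t : ℝ, ‖parHypIntegrand 4 ℓ 0 0 C (t + (Real.pi / 2 : ℝ) * Complex.I)‖ := by
    intro q
    rw [integral_norm_unfoldedTerm h4 (lowerProd_repMatrix_ne_zero hσ hη q.1) hη.length_pos hy hyπ,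
      show lowerProd (repMatrix σ ση q.1) = C from q.2]
  simp only [Function.comp_def, hconst] at hs
  rw [summable_const_iff] at hs
  have hint := integrable_parHypIntegrand (k := 4) (ℓ := ℓ) (m := 0) (n := 0) (by norm_num) hC
    hy hyπ
  have hpos : 0 < ∫ t : ℝ, ‖parHypIntegrand 4 ℓ 0 0 C (t + (Real.pi / 2 : ℝ) * Complex.I)‖ := by
    rw [integral_pos_iff_support_of_nonneg (fun t => norm_nonneg _) hint.norm,
      Function.support_eq_univ fun t =>
        norm_ne_zero_iff.2 (parHypIntegrand_ne_zero hC hη.length_pos hy hyπ t)]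
    simp
  exact (mul_pos (by positivity) hpos).ne' hs

/-- The `n`-th Fourier coefficient on the line `Im u = y` as a series over `C`. -/
theorem hasSum_kloosterman (hΓ : DiscreteTopology Γ) (hσ : IsCuspScaling Γ 𝔞 σ)
    (hk : Even k) (hk4 : 4 ≤ k) (m n : ℤ) (hη : IsHyperbolicScaling Γ η₁ η₂ ση ℓ) (hy : 0 < y)
    (hyπ : y < Real.pi) :
    HasSum (fun C : CSet Γ σ ση => ((|(C : ℝ)| ^ (k / 2))⁻¹ : ℂ) * parHypIntegral k ℓ m n C y *
        kloosterman Γ 𝔞 η₁ η₂ σ ση ℓ m n C)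
      (Complex.exp ((2 * Real.pi * n * y / ℓ : ℝ)) *
        periodicCoeff (lineSeries Γ 𝔞 σ ση ℓ k m y) n) := by
  -- Double cosets are grouped by the value of `lowerProd`. A value not attained by a chosen
  -- representative would do no harm, as an empty fibre contributes 0.
  have h := (hasSum_integral_unfoldedTerm hΓ hσ hk hk4 m n hη hy hyπ).tsum_fiberwise
    fun q => (⟨lowerProd (repMatrix σ ση q), _, (Quotient.out q : Γ).2, rfl⟩ : CSet Γ σ ση)
  convert! h using 1
  ext C
  set ψ : DoubleCosets Γ 𝔞 η₁ η₂ → CSet Γ σ ση :=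
    fun q => ⟨lowerProd (repMatrix σ ση q), _, (Quotient.out q : Γ).2, rfl⟩ with hψ
  have hset : ψ ⁻¹' {C} = kloostermanIndex Γ 𝔞 η₁ η₂ σ ση C := by
    ext q
    simp [hψ, kloostermanIndex, Subtype.ext_iff]
  have hfin := finite_kloostermanIndex hΓ hσ hη C
  rw [hset]
  have hterm : ∀ q : kloostermanIndex Γ 𝔞 η₁ η₂ σ ση C,
      ∫ x, unfoldedTerm k m n ℓ y (repMatrix σ ση q.1) x =
        ((|(C : ℝ)| ^ (k / 2))⁻¹ : ℂ) * parHypIntegral k ℓ m n C y *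
          kloostermanTerm ℓ m n (repMatrix σ ση q.1) := by
    intro q
    rw [integral_unfoldedTerm hk (lowerProd_repMatrix_ne_zero hσ hη q.1) hη.length_pos hy hyπ,
      show lowerProd (repMatrix σ ση q.1) = C from q.2]
  rw [tsum_congr hterm, tsum_mul_left]
  congr 1
  rw [kloosterman, finsum_mem_def, tsum_subtype (kloostermanIndex Γ 𝔞 η₁ η₂ σ ση C)
    (fun q => kloostermanTerm ℓ m n (repMatrix σ ση q)), tsum_eq_finsum]
  exact hfin.subset Set.support_indicator_subset

end Kloosterman

/-! ### The closed formula and the decay of coefficients. -/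

section Coefficients

/-- The hyperbolic Fourier coefficient in terms of `₁F₁`. -/
def hyperbolicCoeff (Γ : Subgroup SL(2, ℝ)) (𝔞 η₁ η₂ : OnePoint ℝ) (σ ση : SL(2, ℝ)) (ℓ : ℝ)
    (k : ℕ) (m n : ℤ) : ℂ :=
  Complex.exp (2 * (Real.pi : ℂ) ^ 2 * n / ℓ) / ℓ *
    Complex.betaIntegral ((k : ℂ) / 2 + 2 * Real.pi * Complex.I * n / ℓ)
      ((k : ℂ) / 2 - 2 * Real.pi * Complex.I * n / ℓ) *
    ∑' C : CSet Γ σ ση, coeffTerm Γ 𝔞 η₁ η₂ σ ση ℓ k m n C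

theorem re_exponent_add (k : ℕ) (ℓ : ℝ) (n : ℤ) :
    ((k : ℂ) / 2 + 2 * Real.pi * Complex.I * n / ℓ).re = k / 2 := by
  rw [← re_exponent k ℓ (-n)]
  congr 1
  push_cast; ring

theorem betaIntegral_ne_zero {a b : ℂ} (ha : 0 < a.re) (hb : 0 < b.re) :
    Complex.betaIntegral a b ≠ 0 := by
  intro h
  have h1 := Complex.Gamma_mul_Gamma_eq_betaIntegral ha hb
  rw [h, mul_zero] at h1
  exact mul_ne_zero (Complex.Gamma_ne_zero_of_re_pos ha) (Complex.Gamma_ne_zero_of_re_pos hb) h1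

/-- For C < 0 the shift by iπ contributes (-1)^(k/2) e^(2π²n/ℓ), which turns |C|^(k/2) into C^(k/2).
For C > 0 there is no such factor, and the exponential in S* cancels the prefactor e^(2π²n/ℓ). -/
theorem term_eq_coeffTerm (hk : Even k) (hk4 : 4 ≤ k) (hy : 0 < y)
    (hyπ : y < Real.pi) {C : ℝ} (hC : C ≠ 0) :
    ((|C| ^ (k / 2))⁻¹ : ℂ) * parHypIntegral k ℓ m n C y *
        kloosterman Γ 𝔞 η₁ η₂ σ ση ℓ m n C =
      Complex.exp (2 * (Real.pi : ℂ) ^ 2 * n / ℓ) / ℓ *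
        Complex.betaIntegral ((k : ℂ) / 2 + 2 * Real.pi * Complex.I * n / ℓ)
          ((k : ℂ) / 2 - 2 * Real.pi * Complex.I * n / ℓ) *
        coeffTerm Γ 𝔞 η₁ η₂ σ ση ℓ k m n C := by
  obtain ⟨l, rfl⟩ := hk
  have hl : (l + l) / 2 = l := by omega
  rw [parHypIntegral_eq (by omega) hC hy hyπ, coeffTerm, kloostermanStar, hl,
    Complex.betaIntegral_symm]
  have hsign : ((|C| ^ l)⁻¹ : ℂ) * (e (-m / (2 * C)) * Complex.exp (signArg C * Complex.I *
        (((l + l : ℕ) : ℂ) / 2 - 2 * Real.pi * Complex.I * n / ℓ))) =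
      Complex.exp (2 * (Real.pi : ℂ) ^ 2 * n / ℓ) *
        Complex.exp (-(Real.pi : ℂ) ^ 2 * n * ((Real.sign C : ℂ) + 1) / ℓ
          - Real.pi * Complex.I * m / C) / (C : ℂ) ^ l := by
    have he : e (-m / (2 * C)) = Complex.exp (-(Real.pi * Complex.I * m / C)) := by
      rw [e]; congr 1; field_simp
    have hCc : (C : ℂ) ≠ 0 := by exact_mod_cast hC
    rw [he, ← Complex.exp_add]
    rcases lt_or_gt_of_ne hC with h | h
    · rw [signArg, if_neg h.not_gt, Real.sign_of_neg h, abs_of_neg h, ← Complex.exp_add]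
      have e1 : (-(Real.pi * Complex.I * m / C) + Real.pi * Complex.I *
          (((l + l : ℕ) : ℂ) / 2 - 2 * Real.pi * Complex.I * n / ℓ) : ℂ) =
          l * (Real.pi * Complex.I) + (2 * (Real.pi : ℂ) ^ 2 * n / ℓ +
            (-(Real.pi : ℂ) ^ 2 * n * (((-1 : ℝ) : ℂ) + 1) / ℓ - Real.pi * Complex.I * m / C)) := by
        push_cast
        ring_nf
        rw [Complex.I_sq]
        ring
      rw [e1, Complex.exp_add (l * _), Complex.exp_nat_mul, Complex.exp_pi_mul_I]
      rw [Complex.ofReal_neg C, neg_pow (C : ℂ), mul_inv, ← inv_pow]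
      have : ((-1 : ℂ)⁻¹) ^ l * (-1) ^ l = 1 := by
        rw [← mul_pow]; norm_num
      generalize Complex.exp (2 * (Real.pi : ℂ) ^ 2 * n / ℓ + (-(Real.pi : ℂ) ^ 2 * n *
        (((-1 : ℝ) : ℂ) + 1) / ℓ - Real.pi * Complex.I * m / C)) = E
      linear_combination ((C : ℂ) ^ l)⁻¹ * E * this
    · rw [signArg, if_pos h, Real.sign_of_pos h, abs_of_pos h, ← Complex.exp_add, div_eq_mul_inv,
        mul_comm]
      congr 2
      push_cast; ring
  linear_combination (Complex.betaIntegral (((l + l : ℕ) : ℂ) / 2 +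
    2 * Real.pi * Complex.I * n / ℓ) (((l + l : ℕ) : ℂ) / 2 - 2 * Real.pi * Complex.I * n / ℓ) *
    hyp1F1 (((l + l : ℕ) : ℂ) / 2 - 2 * Real.pi * Complex.I * n / ℓ) ((l + l : ℕ) : ℂ)
        (2 * Real.pi * Complex.I * m / C) * kloosterman Γ 𝔞 η₁ η₂ σ ση ℓ m n C / ℓ) * hsign

theorem ne_zero_of_mem_CSet (hσ : IsCuspScaling Γ 𝔞 σ) (hη : IsHyperbolicScaling Γ η₁ η₂ ση ℓ)
    {C : ℝ} (hC : C ∈ CSet Γ σ ση) : C ≠ 0 := by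
  obtain ⟨γ, hγ, rfl⟩ := hC
  exact lowerProd_ne_zero hσ hη ⟨γ, hγ⟩

theorem hasSum_coeffTerm (hΓ : DiscreteTopology Γ) (hσ : IsCuspScaling Γ 𝔞 σ)
    (hk : Even k) (hk4 : 4 ≤ k) (m n : ℤ) (hη : IsHyperbolicScaling Γ η₁ η₂ ση ℓ) (hy : 0 < y)
    (hyπ : y < Real.pi) :
    HasSum (fun C : CSet Γ σ ση => Complex.exp (2 * (Real.pi : ℂ) ^ 2 * n / ℓ) / ℓ *
        Complex.betaIntegral ((k : ℂ) / 2 + 2 * Real.pi * Complex.I * n / ℓ)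
          ((k : ℂ) / 2 - 2 * Real.pi * Complex.I * n / ℓ) *
        coeffTerm Γ 𝔞 η₁ η₂ σ ση ℓ k m n C)
      (Complex.exp ((2 * Real.pi * n * y / ℓ : ℝ)) *
        periodicCoeff (lineSeries Γ 𝔞 σ ση ℓ k m y) n) := by
  convert! hasSum_kloosterman hΓ hσ hk hk4 m n hη hy hyπ using 1
  ext C
  rw [term_eq_coeffTerm hk hk4 hy hyπ (ne_zero_of_mem_CSet hσ hη C.2)]

/-- The common prefactor is nonzero, a Beta value being a quotient of nonvanishing Gamma values, so
it can be divided out. -/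
theorem summable_coeffTerm (hΓ : DiscreteTopology Γ) (hσ : IsCuspScaling Γ 𝔞 σ)
    (hk : Even k) (hk4 : 4 ≤ k) (m n : ℤ) (hη : IsHyperbolicScaling Γ η₁ η₂ ση ℓ) :
    Summable fun C : CSet Γ σ ση => coeffTerm Γ 𝔞 η₁ η₂ σ ση ℓ k m n C := by
  have hpi := Real.pi_pos
  have hk' : (4 : ℝ) ≤ k := by exact_mod_cast hk4
  refine (summable_mul_left_iff ?_).1
    (hasSum_coeffTerm hΓ hσ hk hk4 m n hη (y := Real.pi / 2) (by linarith) (by linarith)).summable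
  refine mul_ne_zero (div_ne_zero (Complex.exp_ne_zero _) ?_) (betaIntegral_ne_zero ?_ ?_)
  · exact_mod_cast hη.length_pos.ne'
  · rw [re_exponent_add]; linarith
  · rw [re_exponent]; linarith

/-- The left side does not involve y, so one sequence of coefficients serves all horizontal lines.
-/
theorem hyperbolicCoeff_eq (hΓ : DiscreteTopology Γ) (hσ : IsCuspScaling Γ 𝔞 σ)
    (hk : Even k) (hk4 : 4 ≤ k) (m n : ℤ) (hη : IsHyperbolicScaling Γ η₁ η₂ ση ℓ) (hy : 0 < y)
    (hyπ : y < Real.pi) :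
    hyperbolicCoeff Γ 𝔞 η₁ η₂ σ ση ℓ k m n = Complex.exp ((2 * Real.pi * n * y / ℓ : ℝ)) *
        periodicCoeff (lineSeries Γ 𝔞 σ ση ℓ k m y) n := by
  rw [hyperbolicCoeff, ← tsum_mul_left]
  exact (hasSum_coeffTerm hΓ hσ hk hk4 m n hη hy hyπ).tsum_eq

theorem periodicCoeff_lineSeries (hΓ : DiscreteTopology Γ) (hσ : IsCuspScaling Γ 𝔞 σ)
    (hk : Even k) (hk4 : 4 ≤ k) (m n : ℤ) (hη : IsHyperbolicScaling Γ η₁ η₂ ση ℓ) (hy : 0 < y)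
    (hyπ : y < Real.pi) :
    periodicCoeff (lineSeries Γ 𝔞 σ ση ℓ k m y) n =
      hyperbolicCoeff Γ 𝔞 η₁ η₂ σ ση ℓ k m n * Complex.exp ((-(2 * Real.pi * n * y / ℓ) : ℝ)) := by
  rw [hyperbolicCoeff_eq hΓ hσ hk hk4 m n hη hy hyπ, Complex.ofReal_neg, Complex.exp_neg]
  have := Complex.exp_ne_zero ((2 * Real.pi * n * y / ℓ : ℝ) : ℂ)
  field_simp

theorem exists_hyperbolicCoeff_bound (hΓ : DiscreteTopology Γ) (hσ : IsCuspScaling Γ 𝔞 σ)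
    (hk : Even k) (hk4 : 4 ≤ k) (m : ℤ) (hη : IsHyperbolicScaling Γ η₁ η₂ ση ℓ) (hy : 0 < y)
    (hyπ : y < Real.pi) :
    ∃ B : ℝ, ∀ n, ‖hyperbolicCoeff Γ 𝔞 η₁ η₂ σ ση ℓ k m n‖ ≤
      Real.exp (2 * Real.pi * n * y / ℓ) * B := by
  obtain ⟨b, hb, h⟩ := exists_stripTerm_bound hΓ hσ hk hk4 m ση hη.length_pos hy hyπ
    1
  refine ⟨∑' p, b p, fun n => ?_⟩
  rw [hyperbolicCoeff_eq hΓ hσ hk hk4 m n hη hy hyπ, norm_mul, Complex.norm_exp, Complex.ofReal_re]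
  refine mul_le_mul_of_nonneg_left ?_ (Real.exp_pos _).le
  have h1 : ∀ x ∈ Set.uIoc (0 : ℝ) 1, ‖lineSeries Γ 𝔞 σ ση ℓ k m y x *
      Complex.exp (-(2 * Real.pi * Complex.I * n) * x)‖ ≤ ∑' p, b p := by
    intro x hx
    rw [Set.uIoc_of_le zero_le_one] at hx
    rw [norm_mul, show (-(2 * Real.pi * Complex.I * n) * x : ℂ) =
      ((-(2 * Real.pi * n * x) : ℝ) : ℂ) * Complex.I by push_cast; ring,
      Complex.norm_exp_ofReal_mul_I, mul_one]
    exact tsum_of_norm_bounded hb.hasSum fun p =>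
      h p x (abs_le.2 ⟨by linarith [hx.1], hx.2⟩)
  simpa [periodicCoeff] using intervalIntegral.norm_integral_le_of_norm_le_const h1

theorem summable_periodicCoeff_lineSeries (hΓ : DiscreteTopology Γ) (hσ : IsCuspScaling Γ 𝔞 σ)
    (hk : Even k) (hk4 : 4 ≤ k) (m : ℤ) (hη : IsHyperbolicScaling Γ η₁ η₂ ση ℓ) (hy : 0 < y)
    (hyπ : y < Real.pi) : Summable (periodicCoeff (lineSeries Γ 𝔞 σ ση ℓ k m y)) := by
  have hℓ := hη.length_pos
  have hpi := Real.pi_pos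
  -- The line y/2 below gives the ratio e^(-πy/ℓ) for n ≥ 0, the line (y + π)/2 above the ratio
  -- e^(-π(π - y)/ℓ) for n ≤ 0.
  obtain ⟨B₁, hB₁⟩ := exists_hyperbolicCoeff_bound hΓ hσ hk hk4 m hη (y := y / 2) (by linarith)
    (by linarith)
  obtain ⟨B₂, hB₂⟩ := exists_hyperbolicCoeff_bound hΓ hσ hk hk4 m hη (y := (y + Real.pi) / 2)
    (by linarith) (by linarith)
  have hgeo : ∀ {a : ℝ} (B : ℝ), a < 0 → Summable fun j : ℕ => Real.exp a ^ j * B := fun B ha =>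
    (summable_geometric_of_lt_one (Real.exp_pos _).le (Real.exp_lt_one_iff.2 ha)).mul_right B
  have hnorm : ∀ n : ℤ, ‖periodicCoeff (lineSeries Γ 𝔞 σ ση ℓ k m y) n‖ =
      ‖hyperbolicCoeff Γ 𝔞 η₁ η₂ σ ση ℓ k m n‖ * Real.exp (-(2 * Real.pi * n * y / ℓ)) := by
    intro n
    rw [periodicCoeff_lineSeries hΓ hσ hk hk4 m n hη hy hyπ, norm_mul, Complex.norm_exp,
      Complex.ofReal_re]
  refine Summable.of_nat_of_neg ?_ ?_
  · refine Summable.of_norm_bounded (hgeo B₁ (a := -(Real.pi * y / ℓ))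
      (neg_lt_zero.2 (by positivity))) fun j => ?_
    rw [hnorm]
    refine (mul_le_mul_of_nonneg_right (hB₁ _) (Real.exp_pos _).le).trans_eq ?_
    rw [← Real.exp_nat_mul, mul_right_comm, ← Real.exp_add]
    congr 2
    push_cast; field_simp; ring
  · refine Summable.of_norm_bounded (hgeo B₂ (a := -(Real.pi * (Real.pi - y) / ℓ))
      (neg_lt_zero.2 (by have := sub_pos.2 hyπ; positivity))) fun j => ?_
    rw [hnorm]
    refine (mul_le_mul_of_nonneg_right (hB₂ _) (Real.exp_pos _).le).trans_eq ?_
    rw [← Real.exp_nat_mul, mul_right_comm, ← Real.exp_add]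
    congr 2
    push_cast; field_simp; ring

end Coefficients

/-! ### Existence and uniqueness of the hyperbolic expansion. -/

section Expansion

theorem exp_mul_slash_poincareSeries (hℓ : 0 < ℓ) (z : ℍ) :
    SlashAction.map (k : ℤ) (ση : GL (Fin 2) ℝ) (poincareSeries Γ 𝔞 σ k m) z *
        Complex.exp (Complex.log z * (k / 2)) =
      lineSeries Γ 𝔞 σ ση ℓ k m (Complex.log z).im ((Complex.log z).re / ℓ) := by
  have e1 : linePoint ℓ (Complex.log z).im ((Complex.log z).re / ℓ) = Complex.log z := by
    rw [linePoint, mul_div_cancel₀ _ hℓ.ne', Complex.re_add_im]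
  rw [slash_poincareSeries, lineSeries, ← tsum_mul_right]
  refine tsum_congr fun p => ?_
  rw [e1, stripTerm, Complex.exp_log z.ne_zero]

theorem cpow_mul_exp (hℓ : 0 < ℓ) (n : ℤ) {z : ℂ} (hz : z ≠ 0) :
    z ^ (-(k : ℂ) / 2 + 2 * Real.pi * Complex.I * n / ℓ) * Complex.exp (Complex.log z * (k / 2)) =
      Complex.exp ((-(2 * Real.pi * n * (Complex.log z).im / ℓ) : ℝ)) *
        Complex.exp (2 * Real.pi * Complex.I * n * ((Complex.log z).re / ℓ : ℝ)) := by
  have hℓ' : (ℓ : ℂ) ≠ 0 := by exact_mod_cast hℓ.ne'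
  rw [Complex.cpow_def_of_ne_zero hz, ← Complex.exp_add, ← Complex.exp_add]
  congr 1
  generalize Complex.log z = u
  conv_lhs => rw [← Complex.re_add_im u]
  push_cast
  field_simp
  linear_combination (4 * n * Real.pi * u.im : ℂ) * Complex.I_sq

/-- Multiplication by e^((k/2) log z) turns the expansion at z into a Fourier series on the line Im
u = arg z. -/
theorem hasSum_expansion_iff (hℓ : 0 < ℓ) (c : ℤ → ℂ) (z : ℍ) :
    HasSum (fun n : ℤ => c n * (z : ℂ) ^ (-(k : ℂ) / 2 + 2 * Real.pi * Complex.I * n / ℓ))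
        (SlashAction.map (k : ℤ) (ση : GL (Fin 2) ℝ) (poincareSeries Γ 𝔞 σ k m) z) ↔
      HasSum (fun n : ℤ => c n * Complex.exp ((-(2 * Real.pi * n * (Complex.log z).im / ℓ) : ℝ)) *
          Complex.exp (2 * Real.pi * Complex.I * n * ((Complex.log z).re / ℓ : ℝ)))
        (lineSeries Γ 𝔞 σ ση ℓ k m (Complex.log z).im ((Complex.log z).re / ℓ)) := by
  rw [← exp_mul_slash_poincareSeries hℓ,
    ← hasSum_mul_right_iff (Complex.exp_ne_zero (Complex.log z * (k / 2)))]
  simp only [mul_assoc _ _ (Complex.exp (Complex.log z * (k / 2))), cpow_mul_exp hℓ _ z.ne_zero]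
  simp only [mul_assoc]

theorem isHyperbolicExpansion_iff (hΓ : DiscreteTopology Γ) (hσ : IsCuspScaling Γ 𝔞 σ)
    (hk : Even k) (hk4 : 4 ≤ k) (m : ℤ) (hη : IsHyperbolicScaling Γ η₁ η₂ ση ℓ) (c : ℤ → ℂ) :
    IsHyperbolicExpansion k ση ℓ (poincareSeries Γ 𝔞 σ k m) c ↔
      c = hyperbolicCoeff Γ 𝔞 η₁ η₂ σ ση ℓ k m := by
  have hℓ := hη.length_pos
  have hpi := Real.pi_pos
  constructor
  · intro h
    -- Uniqueness needs a single line; the middle of the strip is used.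
    have hy : 0 < Real.pi / 2 := by linarith
    have hyπ : Real.pi / 2 < Real.pi := by linarith
    have h1 : ∀ x : ℝ, HasSum (fun n : ℤ =>
        c n * Complex.exp ((-(2 * Real.pi * n * (Real.pi / 2) / ℓ) : ℝ)) *
          Complex.exp (2 * Real.pi * Complex.I * n * x))
        (lineSeries Γ 𝔞 σ ση ℓ k m (Real.pi / 2) x) := by
      intro x
      have him := linePoint_im ℓ (Real.pi / 2) x
      have hlog : Complex.log (Complex.exp (linePoint ℓ (Real.pi / 2) x)) =
          linePoint ℓ (Real.pi / 2) x :=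
        Complex.log_exp (by rw [him]; linarith) (by rw [him]; linarith)
      have hre : (linePoint ℓ (Real.pi / 2) x).re / ℓ = x := by
        rw [linePoint, Complex.add_re, Complex.ofReal_re, Complex.re_ofReal_mul, Complex.I_re,
          mul_zero, add_zero, mul_div_cancel_left₀ _ hℓ.ne']
      have h2 := (hasSum_expansion_iff hℓ c _).1
        (h ⟨Complex.exp (linePoint ℓ (Real.pi / 2) x), exp_im_pos (by rw [him]; exact hy)
          (by rw [him]; exact hyπ)⟩)
      simp only [hlog, him, hre] at h2
      exact h2
    have h3 := periodicCoeff_eq_of_hasSum h1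
    ext n
    have h4 := congrFun h3 n
    rw [periodicCoeff_lineSeries hΓ hσ hk hk4 m n hη hy hyπ] at h4
    exact (mul_right_cancel₀ (Complex.exp_ne_zero _) h4).symm
  · rintro rfl z
    rw [hasSum_expansion_iff hℓ]
    have him : (Complex.log z).im = Complex.arg z := Complex.log_im _
    have hy : 0 < (Complex.log z).im := by
      rw [him]
      refine lt_of_le_of_ne (Complex.arg_nonneg_iff.2 z.im_pos.le) fun h => ?_
      have := (Complex.arg_eq_zero_iff.1 h.symm).2
      exact z.im_pos.ne' this
    have hyπ : (Complex.log z).im < Real.pi := by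
      rw [him]
      refine lt_of_le_of_ne (Complex.arg_le_pi _) fun h => ?_
      exact z.im_pos.ne' (Complex.arg_eq_pi_iff.1 h).2
    have h := hasSum_periodicCoeff (continuous_lineSeries hΓ hσ hk hk4 m ση hℓ hy hyπ)
      (periodic_lineSeries hk hσ hη hy hyπ)
      (summable_periodicCoeff_lineSeries hΓ hσ hk hk4 m hη hy hyπ) ((Complex.log z).re / ℓ)
    simp only [periodicCoeff_lineSeries hΓ hσ hk hk4 m _ hη hy hyπ] at h
    exact h

end Expansion

end

end HyperbolicExpansion

end

theorem theorem6p5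
    (Γ : Subgroup SL(2, ℝ)) (hΓ : HyperbolicExpansion.IsFuchsianFirstKind Γ)
    (k : ℕ) (hk : Even k) (hk4 : 4 ≤ k)
    (𝔞 : OnePoint ℝ) (h𝔞 : IsCusp 𝔞 (Γ.map Matrix.SpecialLinearGroup.toGL))
    (σ𝔞 : SL(2, ℝ)) (hσ𝔞 : HyperbolicExpansion.IsCuspScaling Γ 𝔞 σ𝔞)
    (η₁ η₂ : OnePoint ℝ) (hη : HyperbolicExpansion.IsHyperbolicPair Γ η₁ η₂)
    (ση : SL(2, ℝ)) (ℓ : ℝ) (hση : HyperbolicExpansion.IsHyperbolicScaling Γ η₁ η₂ ση ℓ)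
    (m : ℤ) :
    -- the Poincaré series converges absolutely and the Kloosterman sums are finite sums
    (∀ z : ℍ, Summable fun q : HyperbolicExpansion.CuspCosets Γ 𝔞 =>
      HyperbolicExpansion.poincareTerm k m σ𝔞 (q.out : Γ) z) ∧
    (∀ C : ℝ, (HyperbolicExpansion.kloostermanIndex Γ 𝔞 η₁ η₂ σ𝔞 ση C).Finite) ∧
    -- the hyperbolic Fourier expansion exists, its coefficients `c n` are unique, and
    ∃ c : ℤ → ℂ,
      (∀ c' : ℤ → ℂ, HyperbolicExpansion.IsHyperbolicExpansion k ση ℓ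
        (HyperbolicExpansion.poincareSeries Γ 𝔞 σ𝔞 k m) c' ↔ c' = c) ∧
      ∀ n : ℤ,
        -- the explicit formula with `₁F₁`
        (Summable fun C : HyperbolicExpansion.CSet Γ σ𝔞 ση =>
          HyperbolicExpansion.coeffTerm Γ 𝔞 η₁ η₂ σ𝔞 ση ℓ k m n C) ∧
        c n = Complex.exp (2 * (Real.pi : ℂ) ^ 2 * n / ℓ) / ℓ *
          Complex.betaIntegral ((k : ℂ) / 2 + 2 * Real.pi * Complex.I * n / ℓ)
            ((k : ℂ) / 2 - 2 * Real.pi * Complex.I * n / ℓ) *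
          ∑' C : HyperbolicExpansion.CSet Γ σ𝔞 ση,
            HyperbolicExpansion.coeffTerm Γ 𝔞 η₁ η₂ σ𝔞 ση ℓ k m n C ∧
        -- the general formula with the integrals over any line `Im u = y`, `0 < y < π`
        ∀ y : ℝ, 0 < y → y < Real.pi →
          (∀ C ∈ HyperbolicExpansion.CSet Γ σ𝔞 ση, MeasureTheory.Integrable fun t : ℝ =>
            HyperbolicExpansion.parHypIntegrand k ℓ m n C (t + y * Complex.I)) ∧
          HasSum (fun C : HyperbolicExpansion.CSet Γ σ𝔞 ση =>
            ((|(C : ℝ)| ^ (k / 2))⁻¹ : ℂ) *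
              HyperbolicExpansion.parHypIntegral k ℓ m n C y *
              HyperbolicExpansion.kloosterman Γ 𝔞 η₁ η₂ σ𝔞 ση ℓ m n C) (c n) := by
  have hd := hΓ.discrete
  refine ⟨fun z => HyperbolicExpansion.summable_poincareTerm hd hσ𝔞 hk hk4 m z,
    fun C => HyperbolicExpansion.finite_kloostermanIndex hd hσ𝔞 hση C,
    HyperbolicExpansion.hyperbolicCoeff Γ 𝔞 η₁ η₂ σ𝔞 ση ℓ k m,
    fun c' => HyperbolicExpansion.isHyperbolicExpansion_iff hd hσ𝔞 hk hk4 m hση c', fun n =>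
      ⟨HyperbolicExpansion.summable_coeffTerm hd hσ𝔞 hk hk4 m n hση, rfl, fun y hy hyπ =>
        ⟨fun C hC => HyperbolicExpansion.integrable_parHypIntegrand (by omega)
          (HyperbolicExpansion.ne_zero_of_mem_CSet hσ𝔞 hση hC) hy hyπ, ?_⟩⟩⟩
  rw [HyperbolicExpansion.hyperbolicCoeff_eq hd hσ𝔞 hk hk4 m n hση hy hyπ]
  exact HyperbolicExpansion.hasSum_kloosterman hd hσ𝔞 hk hk4 m n hση hy hyπ
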